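/- Let $n,m,h$ be natural numbers with $h\ge 1$. Consider a system $$\frac{\partial^h u^i}{\partial t^h}=F^i,\qquad i=1,\dots,m, \tag{1}$$ in the independent variables $t,x_1,\dots,x_n$. For $I\in\mathbb Z_+^n$ write $|I|=i_1+\dots+i_n$ and $u^i_{s,I}=\partial_t^s\partial_{x_1}^{i_1}\cdots\partial_{x_n}^{i_n}u^i$. The space with coordinates $t,\ x_j,\ u^i_{s,I}$ ($s<h$) carries the product topology, $U$ is an open subset of it, and all functions are real functions on $U$ that are smooth functions of finitely many of these coordinates; $F^i$ depends only on $t$, $x_j$, the $u^b_{0,I}$ and the $u^a_{s,0}$, $s<h$. The total derivatives are $$D_{x_j}=\partial_{x_j}+\sum_{k,s,I}u^k_{s,I+1_j}\frac{\partial}{\partial u^k_{s,I}},\qquad D_t=\partial_t+\sum_{k,I,\,s<h-1}u^k_{s+1,I}\frac{\partial}{\partial u^k_{s,I}}+\sum_{k,I}D_x^I(F^k)\frac{\partial}{\partial u^k_{h-1,I}} .$$ A conserved current is a tuple $J=(J_0,\dots,J_n)$ with $D_tJ_0+\sum_jD_{x_j}J_j=0$. With $D_0=D_t$, $D_j=D_{x_j}$,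 it is trivial if $J_k=\sum_{l<k}D_l(\mathcal L_{lk})-\sum_{k<l}D_l(\mathcal L_{kl})$ for some functions $\mathcal L_{kl}$. A conservation law is a class of conserved currents modulo trivial ones; its characteristic is $\chi=(\chi_1,\dots,\chi_m)$, $\chi_i=\sum_I(-1)^{|I|}D_x^I\bigl(\partial J_0/\partial u^i_{h-1,I}\bigr)$. The order $\mathrm o(f)$ of a (vector-)function $f$ is the largest $|I|$ such that $\partial f/\partial u^j_{s,I}\not\equiv 0$ for some $s,j$, and $-1$ if there is none; $\mathrm t(f)$ is the largest $s$ such that $\partial f/\partial u^j_{s,I}\not\equiv0$ for some $j$ and some $I$ with $|I|=\mathrm o(f)$. The symbol of $f$ at $\theta\in U$ is the matrix $\mathbf S_f(\theta)$ with entries $\sum_{|I|=\mathrm o(f)}\frac{\partial f_i}{\partial u^j_{\mathrm t(f),I}}(\theta)\,q^I\in\mathbb R[q_1,\dots,q_n]$. The order of a conservation law is the order of its characteristic. Put $N=\mathrm o(F^1,\dots,F^m)$, assume $N>0$, and let $A(\theta)=\mathbf S_F(\theta)$, regarded as a matrix over the field $\mathbb R(q_1,\dots,q_n)$. Using the Leibniz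 rule write the operators $$L_{ij}=\sum_I(-1)^{|I|}D_x^I\circ\frac{\partial F^j}{\partial u^i_{0,I}}+\sum_{0<s<h}(-1)^sD_t^s\circ\frac{\partial F^j}{\partial u^i_{s,0}}$$ as $\sum_{|I|\le N}f^{ij}_ID_x^I+\sum_{0<s<h}g^{ij}_sD_t^s$, and put $O=\max_{i,j,I,s}\{-1,\ \mathrm o(f^{ij}_I)-N,\ \mathrm o(g^{ij}_s)-N\}$. Theorem. Suppose that $N+h$ is odd and that (1) has a conservation law of order greater than $O$, with characteristic $\chi$. Then $\mathbf S_\chi(\theta)\ne0$ for some $\theta\in U$, and for every $\theta\in U$ with $\mathbf S_\chi(\theta)\neq 0$ the polynomials $d(\lambda)=\det(A(\theta)-\lambda\mathbf I)$ and $d(-\lambda)$ over $\mathbb R(q_1,\dots,q_n)$ have a common divisor of positive degree; equivalently, there are eigenvalues $\lambda_1,\lambda_2$ of $A(\theta)$ in the algebraic closure of $\mathbb R(q_1,\dots,q_n)$ with $\lambda_1+\lambda_2=0$. If, moreover, $U$ is connected and the $F^i$ are real analytic, then this holds at every $\theta\in U$. (The two forms of the conclusion are equivalent at every $\theta\in U$.)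 -/

import Mathlib

open scoped ContDiff

noncomputable section

namespace GenEvol

/-- The coordinates `t`, `x_j` and `u^i_{s,I}` with `s < h` on the infinite prolongation of a system
`∂^h u^i / ∂t^h = F^i` with `n` space variables and `m` unknown functions. Here `u^i_{s,I}` stands
for the derivative of `u^i` taken `s` times in `t` and `I j` times in each `x_j`. -/
inductive Coord (n m h : ℕ) : Type
  | t : Coord n m h
  | x (j : Fin n) : Coord n m h
  | u (i : Fin m) (s : Fin h) (I : Fin n →₀ ℕ) : Coord n m h
  deriving DecidableEq

/-- Points of the infinite prolongation, with the product topology. -/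
abbrev Jet (n m h : ℕ) : Type := Coord n m h → ℝ

/-- Functions of the coordinates. Only their values on the domain under consideration matter. -/
abbrev JetFun (n m h : ℕ) : Type := Jet n m h → ℝ

variable {n m h : ℕ}

/-- `f` is, on `U`, a function of class `C^r` of finitely many of the variables in `V`. -/
def IsFunOf (U : Set (Jet n m h)) (V : Set (Coord n m h)) (r : WithTop ℕ∞)
    (f : JetFun n m h) : Prop :=
  ∃ s : Finset (Coord n m h), (s : Set (Coord n m h)) ⊆ V ∧
    ∃ g : (s → ℝ) → ℝ, ContDiffOn ℝ r g (s.restrict '' U) ∧ ∀ θ ∈ U, f θ = g (s.restrict θ)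

/-- Elements of the algebra of smooth functions on `U`, each depending on finitely many coordinates. -/
def IsSmooth (U : Set (Jet n m h)) (f : JetFun n m h) : Prop :=
  IsFunOf U Set.univ ∞ f

/-- The partial derivative `∂f/∂c` with respect to the coordinate `c`. -/
def pd (c : Coord n m h) (f : JetFun n m h) : JetFun n m h :=
  fun θ => deriv (fun r : ℝ => f (Function.update θ c r)) (θ c)

/-- The total derivative with respect to `x_j`,
`∂/∂x_j + ∑ u^k_{s,I+1_j} ∂/∂u^k_{s,I}`. -/
def Dx (j : Fin n) (f : JetFun n m h) : JetFun n m h :=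
  fun θ => pd (.x j) f θ +
    ∑ᶠ p : Fin m × Fin h × (Fin n →₀ ℕ),
      θ (.u p.1 p.2.1 (p.2.2 + Finsupp.single j 1)) * pd (.u p.1 p.2.1 p.2.2) f θ

/-- The iterated total derivative `D_{x_1}^{I_1} ∘ ⋯ ∘ D_{x_n}^{I_n}`. -/
def DxI (I : Fin n →₀ ℕ) (f : JetFun n m h) : JetFun n m h :=
  (List.finRange n).foldr (fun j g => (Dx j)^[I j] g) f

/-- The variables `t`, `x_j`, `u^b_{0,I}`, `u^a_{s,0}` on which the right-hand sides may depend. -/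
def admissibleVars (n m h : ℕ) : Set (Coord n m h) :=
  {c | ∀ (i : Fin m) (s : Fin h) (I : Fin n →₀ ℕ), c = .u i s I → (s : ℕ) = 0 ∨ I = 0}

/-- A system `∂^h u^i / ∂t^h = F^i`, `i = 1, …, m`, of generalized evolution form, with right-hand
sides smooth on an open domain `U`. -/
structure GenEvolSystem (n m h : ℕ) where
  h_pos : 0 < h
  U : Set (Jet n m h)
  isOpen_U : IsOpen U
  F : Fin m → JetFun n m h
  smooth_F : ∀ i, IsFunOf U (admissibleVars n m h) ∞ (F i)

/-- The order of a vector-function on `U`: the largest `|I|` such that `f` really depends on some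
`u^j_{s,I}`, and `-1` if there is none. -/
def order (U : Set (Jet n m h)) {k : ℕ} (f : Fin k → JetFun n m h) : ℤ :=
  sSup (insert (-1) {d : ℤ | ∃ (i : Fin k) (j : Fin m) (s : Fin h) (I : Fin n →₀ ℕ),
    (∃ θ ∈ U, pd (.u j s I) (f i) θ ≠ 0) ∧ d = (I.degree : ℤ)})

/-- The largest `s` such that `f` really depends on some `u^j_{s,I}` with `|I|` the order of `f`. -/
def tOrder (U : Set (Jet n m h)) {k : ℕ} (f : Fin k → JetFun n m h) : ℕ :=
  sSup {b : ℕ | ∃ (i : Fin k) (j : Fin m) (s : Fin h) (I : Fin n →₀ ℕ),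
    (∃ θ ∈ U, pd (.u j s I) (f i) θ ≠ 0) ∧ (I.degree : ℤ) = order U f ∧ b = (s : ℕ)}

/-- The matrix with entries `∑_{|I| = a} (∂f_i/∂u^j_{b,I}) q^I`, its coefficients evaluated
at `θ`. -/
def symbolMatrix (a b : ℕ) {k : ℕ} (f : Fin k → JetFun n m h) (θ : Jet n m h) :
    Matrix (Fin k) (Fin m) (MvPolynomial (Fin n) ℝ) :=
  Matrix.of fun i j => ∑ I ∈ Finset.finsuppAntidiag (Finset.univ : Finset (Fin n)) a,
    MvPolynomial.monomial I (if hb : b < h then pd (.u j ⟨b, hb⟩ I) (f i) θ else 0)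

/-- The symbol of a vector-function, its coefficients evaluated at `θ`. -/
def symbol (U : Set (Jet n m h)) {k : ℕ} (f : Fin k → JetFun n m h) (θ : Jet n m h) :
    Matrix (Fin k) (Fin m) (MvPolynomial (Fin n) ℝ) :=
  symbolMatrix (order U f).toNat (tOrder U f) f θ

/-- The field of rational functions in `q_1, …, q_n`. -/
abbrev RatFunc (n : ℕ) : Type := FractionRing (MvPolynomial (Fin n) ℝ)

namespace GenEvolSystem

variable (E : GenEvolSystem n m h)

/-- The expression for the time derivative of `u^k_{s,I}`: it is `u^k_{s+1,I}` if `s < h - 1` and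
`D_x^I(F^k)` if `s = h - 1`. -/
def dtCoord (k : Fin m) (s : Fin h) (I : Fin n →₀ ℕ) : JetFun n m h :=
  fun θ => if hs : (s : ℕ) + 1 < h then θ (.u k ⟨s + 1, hs⟩ I) else DxI I (E.F k) θ

/-- The total derivative with respect to `t`, restricted to the system. -/
def Dt (f : JetFun n m h) : JetFun n m h :=
  fun θ => pd .t f θ +
    ∑ᶠ p : Fin m × Fin h × (Fin n →₀ ℕ),
      E.dtCoord p.1 p.2.1 p.2.2 θ * pd (.u p.1 p.2.1 p.2.2) f θ

/-- The total derivatives, numbered so that `0` is the one in `t` and `j + 1` the one in `x_j`. -/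
def totalD (k : Fin (n + 1)) : JetFun n m h → JetFun n m h :=
  Fin.cases (motive := fun _ => JetFun n m h → JetFun n m h) E.Dt (fun j => Dx j) k

/-- Conserved currents `(J_0, J_1, …, J_n)`. -/
def IsConservedCurrent (J : Fin (n + 1) → JetFun n m h) : Prop :=
  (∀ k, IsSmooth E.U (J k)) ∧ ∀ θ ∈ E.U, ∑ k, E.totalD k (J k) θ = 0

/-- Trivial currents. -/
def IsTrivialCurrent (J : Fin (n + 1) → JetFun n m h) : Prop :=
  ∃ Λ : Fin (n + 1) → Fin (n + 1) → JetFun n m h, (∀ k l, IsSmooth E.U (Λ k l)) ∧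
    ∀ k, ∀ θ ∈ E.U, J k θ =
      ∑ l ∈ Finset.Iio k, E.totalD l (Λ l k) θ - ∑ l ∈ Finset.Ioi k, E.totalD l (Λ k l) θ

/-- Conservation laws: classes of conserved currents modulo trivial ones. -/
def IsConservationLaw (c : Set (Fin (n + 1) → JetFun n m h)) : Prop :=
  ∃ J, E.IsConservedCurrent J ∧
    c = {J' | E.IsConservedCurrent J' ∧ E.IsTrivialCurrent (J' - J)}

/-- The characteristic `χ_i = ∑_I (-1)^{|I|} D_x^I (∂J_0/∂u^i_{h-1,I})` of a current. -/
def currentCharacteristic (J : Fin (n + 1) → JetFun n m h) (i : Fin m) : JetFun n m h :=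
  fun θ => ∑ᶠ I : Fin n →₀ ℕ,
    (-1 : ℝ) ^ I.degree *
      DxI I (pd (.u i ⟨h - 1, Nat.sub_lt E.h_pos Nat.one_pos⟩ I) (J 0)) θ

/-- `χ` is the characteristic of the conservation law `c`. -/
def IsCharacteristic (c : Set (Fin (n + 1) → JetFun n m h)) (χ : Fin m → JetFun n m h) : Prop :=
  ∃ J ∈ c, ∀ i, ∀ θ ∈ E.U, χ i θ = E.currentCharacteristic J i θ

/-- The number `N`, the order of the right-hand side (meant for systems where it is positive). -/
def N : ℕ := (order E.U E.F).toNat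

/- The operator of the adjoint linearized equation `(-1)^h D_t^h χ = L χ` has the entries
`L_{ij} = ∑_I (-1)^{|I|} D_x^I ∘ ∂F^j/∂u^i_{0,I} + ∑_{0 < s < h} (-1)^s D_t^s ∘ ∂F^j/∂u^i_{s,0}`.
By the Leibniz rule `D^I ∘ a = ∑_{J ≤ I} binom(I, J) D^{I-J}(a) D^J` it takes the form
`L_{ij} = ∑_J coeffX i j J • D_x^J + ∑_{0 < r < h} coeffT i j r • D_t^r`. -/

/-- The coefficient of `D_x^J` in `L_{ij}`; the one of the identity (`J = 0`) also gets the
zeroth-order contributions of the operators `D_t^s ∘ ∂F^j/∂u^i_{s,0}`, `0 < s < h`. -/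
def coeffX (i j : Fin m) (J : Fin n →₀ ℕ) : JetFun n m h :=
  fun θ =>
    (∑ᶠ K : Fin n →₀ ℕ,
      (-1 : ℝ) ^ (J + K).degree * (∏ l, ((J l + K l).choose (J l) : ℝ)) *
        DxI K (pd (.u i ⟨0, E.h_pos⟩ (J + K)) (E.F j)) θ) +
    if J = 0 then
      ∑ s : Fin h, if 0 < (s : ℕ) then
        (-1 : ℝ) ^ (s : ℕ) * (E.Dt)^[(s : ℕ)] (pd (.u i s 0) (E.F j)) θ else 0
    else 0

/-- The coefficient of `D_t^r`, `0 < r < h`, in `L_{ij}`. -/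
def coeffT (i j : Fin m) (r : ℕ) : JetFun n m h :=
  fun θ => ∑ s : Fin h, if r ≤ (s : ℕ) then
    (-1 : ℝ) ^ (s : ℕ) * ((s : ℕ).choose r : ℝ) *
      (E.Dt)^[(s : ℕ) - r] (pd (.u i s 0) (E.F j)) θ else 0

/-- The order of a single function on the domain of the system. -/
def ord (f : JetFun n m h) : ℤ := order E.U (fun _ : Fin 1 => f)

/-- The number `O`, the maximum of `-1` and of the orders of the coefficients of `L` minus `N`. -/
def O : ℤ :=
  sSup (insert (-1)
    ({d : ℤ | ∃ (i j : Fin m) (J : Fin n →₀ ℕ), J.degree ≤ E.N ∧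
        d = E.ord (E.coeffX i j J) - E.N} ∪
     {d : ℤ | ∃ (i j : Fin m) (r : ℕ), 0 < r ∧ r < h ∧
        d = E.ord (E.coeffT i j r) - E.N}))

/-- The symbol `A` of the right-hand side at `θ`, as a matrix over the field of rational functions
in `q_1, …, q_n`. -/
def A (θ : Jet n m h) : Matrix (Fin m) (Fin m) (RatFunc n) :=
  (symbol E.U E.F θ).map (algebraMap (MvPolynomial (Fin n) ℝ) (RatFunc n))

end GenEvolSystem

/-- The characteristic polynomial in the normalization `d(λ) = det (A - λ I)`. -/
def charDet {K : Type*} [Field K] (A : Matrix (Fin m) (Fin m) K) : Polynomial K :=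
  (A.map Polynomial.C - Matrix.scalar (Fin m) (Polynomial.X : Polynomial K)).det

/-- `d(λ)` and `d(-λ)` have a common divisor of positive degree. -/
def HasCommonDivisor {K : Type*} [Field K] (A : Matrix (Fin m) (Fin m) K) : Prop :=
  ∃ p : Polynomial K, 0 < p.natDegree ∧ p ∣ charDet A ∧
    p ∣ (charDet A).comp (-Polynomial.X)

/-- There are eigenvalues of `A` in the algebraic closure of the field whose sum is zero. -/
def HasOppositeEigenvalues {K : Type*} [Field K] (A : Matrix (Fin m) (Fin m) K) : Prop :=
  ∃ μ₁ μ₂ : AlgebraicClosure K,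
    Module.End.HasEigenvalue
      (Matrix.toLin' (A.map (algebraMap K (AlgebraicClosure K)))) μ₁ ∧
    Module.End.HasEigenvalue
      (Matrix.toLin' (A.map (algebraMap K (AlgebraicClosure K)))) μ₂ ∧
    μ₁ + μ₂ = 0

end GenEvol

end

open scoped ContDiff

noncomputable section

namespace GenEvol

variable {n m h : ℕ}

/-! Write E_{i,s}(f) = ∑_I (-D_x)^I (∂f/∂u^i_{s,I}), so that χ_i = E_{i,h-1}(J_0). These Euler
operators annihilate D_x-divergences (`euler_Dx` with constant second argument), hence E_{i,s}(D_t
J_0) = 0 for a conserved current. Commuting E_{i,s} past D_t (`euler_Dt`) turns this into a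
recursion linking levels s and s - 1. Applying (-D_t)^s and summing over s telescopes, and the
adjoint linearized equation (-1)^h D_t^h χ = L χ remains (`iterate_neg_Dt_euler`, with L expanded by
the Leibniz rule in `adjoint_eq_sum_coeff`).

Let k be the order of χ and r its t-order, and differentiate this equation by u^l_{r,M} with |M| = k
+ N. On the left, h applications of D_t carry a leading variable u_{r,I} up to level h - 1, through
the right-hand side F to u_{0,I+K} with |K| = N, and back up to level r. On the right, k > O makes
the coefficients of L independent of all variables of order k + N or more, the D_t^s with s < h do
not reach u_{r,M}, and only the D_x^J with |J| = N contribute. What is left (`leading_identity`)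
says coefficientwise that (-1)^h S A = (-1)^N Aᵀ S, where S is the symbol of χ. For N + h odd this
is Aᵀ S + S A = 0 (`symbol_intertwine`).

The rest is linear algebra (`hasCommonDivisor_of_intertwine`). From Aᵀ S = S (-A) and
Cayley–Hamilton, 0 = d(Aᵀ) S = S d(-A). If d(λ) and d(-λ) were coprime, a Bézout identity evaluated
at A would make d(-A) invertible, forcing S = 0.

In the analytic case, solvability of Aᵀ B + B A = 0 with B ≠ 0 is the vanishing of one determinant,
polynomial in q with coefficients analytic in θ. It vanishes on the open set where S ≠ 0, hence on
all of the connected domain. -/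

/-! ### Calculus of functions of finitely many jet coordinates. -/

/-- A projection of a product to some of its factors is open. This makes `ContDiffOn` on the image
give genuine Fréchet derivatives of the representing function. -/
theorem isOpen_restrict_image {U : Set (Jet n m h)} (hU : IsOpen U) (s : Finset (Coord n m h)) :
    IsOpen (s.restrict '' U) := by
  have h1 : (s.restrict : Jet n m h → (s → ℝ)) =
      Prod.fst ∘ Homeomorph.piEquivPiSubtypeProd (fun c => c ∈ s) (fun _ : Coord n m h => ℝ) := rfl
  rw [h1, Set.image_comp]
  exact isOpenMap_fst _ ((Homeomorph.isOpenMap _) _ hU)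

/-- Openness keeps the coordinate line through θ inside U near θ, so partial derivatives on U see
only the values on U. -/
theorem eventually_update_mem {U : Set (Jet n m h)} (hU : IsOpen U) {θ : Jet n m h} (hθ : θ ∈ U)
    (c : Coord n m h) : ∀ᶠ r in nhds (θ c), Function.update θ c r ∈ U := by
  have h1 : Continuous fun r : ℝ => Function.update θ c r := continuous_const.update c continuous_id
  refine h1.continuousAt.eventually_mem ?_
  rw [Function.update_eq_self]
  exact hU.mem_nhds hθ

theorem pd_congr {U : Set (Jet n m h)} (hU : IsOpen U) {f g : JetFun n m h}
    (hfg : ∀ θ ∈ U, f θ = g θ) (c : Coord n m h) {θ : Jet n m h} (hθ : θ ∈ U) :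
    pd c f θ = pd c g θ :=
  Filter.EventuallyEq.deriv_eq ((eventually_update_mem hU hθ c).mono fun _ hr => hfg _ hr)

theorem restrict_update_mem (s : Finset (Coord n m h)) {c : Coord n m h} (hc : c ∈ s)
    (θ : Jet n m h) (r : ℝ) :
    s.restrict (Function.update θ c r) = Function.update (s.restrict θ) ⟨c, hc⟩ r := by
  ext d
  by_cases hd : d = ⟨c, hc⟩
  · subst hd; simp
  · have : (d : Coord n m h) ≠ c := fun h => hd (Subtype.ext h)
    simp [hd, this]

theorem restrict_update_notMem (s : Finset (Coord n m h)) {c : Coord n m h} (hc : c ∉ s)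
    (θ : Jet n m h) (r : ℝ) : s.restrict (Function.update θ c r) = s.restrict θ := by
  ext d
  have : (d : Coord n m h) ≠ c := fun h => hc (h ▸ d.2)
  simp [this]

/-- The vector dual to the coordinate `c` in the space of the coordinates from `s`. -/
def coordVec (s : Finset (Coord n m h)) (c : Coord n m h) : s → ℝ :=
  if hc : c ∈ s then Pi.single ⟨c, hc⟩ 1 else 0

theorem hasDerivAt_restrict_update (s : Finset (Coord n m h)) (θ : Jet n m h) (c : Coord n m h) :
    HasDerivAt (fun r : ℝ => s.restrict (Function.update θ c r)) (coordVec s c) (θ c) := by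
  unfold coordVec
  split_ifs with hc
  · simp_rw [restrict_update_mem s hc]
    exact hasDerivAt_update (s.restrict θ) ⟨c, hc⟩ (θ c)
  · simp_rw [restrict_update_notMem s hc]
    exact hasDerivAt_const _ _

theorem hasDerivAt_update_of_rep {U : Set (Jet n m h)} (hU : IsOpen U) {s : Finset (Coord n m h)}
    {g : (s → ℝ) → ℝ} {r : WithTop ℕ∞} (hr : r ≠ 0) (hg : ContDiffOn ℝ r g (s.restrict '' U))
    {f : JetFun n m h} (hf : ∀ θ ∈ U, f θ = g (s.restrict θ)) (c : Coord n m h)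
    {θ : Jet n m h} (hθ : θ ∈ U) :
    HasDerivAt (fun r : ℝ => f (Function.update θ c r))
      (fderiv ℝ g (s.restrict θ) (coordVec s c)) (θ c) := by
  have hmem : s.restrict θ ∈ s.restrict '' U := ⟨θ, hθ, rfl⟩
  have h1 : HasFDerivAt g (fderiv ℝ g (s.restrict θ)) (s.restrict θ) :=
    ((hg.differentiableOn hr).differentiableAt
      ((isOpen_restrict_image hU s).mem_nhds hmem)).hasFDerivAt
  have h2 := hasDerivAt_restrict_update s θ c
  have h3 : HasFDerivAt g (fderiv ℝ g (s.restrict θ))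
      (s.restrict (Function.update θ c (θ c))) := by
    rwa [Function.update_eq_self]
  exact (h3.comp_hasDerivAt (θ c) h2).congr_of_eventuallyEq
    ((eventually_update_mem hU hθ c).mono fun _ hr => hf _ hr)

theorem IsFunOf.hasDerivAt {U : Set (Jet n m h)} (hU : IsOpen U) {V : Set (Coord n m h)}
    {r : WithTop ℕ∞} (hr : r ≠ 0) {f : JetFun n m h} (hf : IsFunOf U V r f) (c : Coord n m h)
    {θ : Jet n m h} (hθ : θ ∈ U) :
    HasDerivAt (fun r : ℝ => f (Function.update θ c r)) (pd c f θ) (θ c) := by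
  obtain ⟨s, -, g, hg, hfg⟩ := hf
  exact (hasDerivAt_update_of_rep hU hr hg hfg c hθ).differentiableAt.hasDerivAt

theorem pd_eq_of_rep {U : Set (Jet n m h)} (hU : IsOpen U) {s : Finset (Coord n m h)}
    {g : (s → ℝ) → ℝ} {r : WithTop ℕ∞} (hr : r ≠ 0) (hg : ContDiffOn ℝ r g (s.restrict '' U))
    {f : JetFun n m h} (hf : ∀ θ ∈ U, f θ = g (s.restrict θ)) (c : Coord n m h)
    {θ : Jet n m h} (hθ : θ ∈ U) :
    pd c f θ = fderiv ℝ g (s.restrict θ) (coordVec s c) :=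
  (hasDerivAt_update_of_rep hU hr hg hf c hθ).deriv

theorem contDiffOn_fderiv_apply {U : Set (Jet n m h)} (hU : IsOpen U) {s : Finset (Coord n m h)}
    {g : (s → ℝ) → ℝ} {r r' : WithTop ℕ∞} (hr : r' + 1 ≤ r)
    (hg : ContDiffOn ℝ r g (s.restrict '' U)) (v : s → ℝ) :
    ContDiffOn ℝ r' (fun y => fderiv ℝ g y v) (s.restrict '' U) :=
  (hg.fderiv_of_isOpen (isOpen_restrict_image hU s) hr).clm_apply contDiffOn_const

theorem ne_zero_of_add_one_le {r r' : WithTop ℕ∞} (hr : r' + 1 ≤ r) : r ≠ 0 := by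
  rintro rfl
  have h1 : (1 : WithTop ℕ∞) ≤ 0 := le_trans le_add_self hr
  exact absurd h1 (by simp)

theorem IsFunOf.pd {U : Set (Jet n m h)} (hU : IsOpen U) {V : Set (Coord n m h)}
    {r r' : WithTop ℕ∞} (hr : r' + 1 ≤ r) {f : JetFun n m h} (hf : IsFunOf U V r f)
    (c : Coord n m h) : IsFunOf U V r' (pd c f) := by
  obtain ⟨s, hs, g, hg, hfg⟩ := hf
  exact ⟨s, hs, fun y => fderiv ℝ g y (coordVec s c), contDiffOn_fderiv_apply hU hr hg _,
    fun θ hθ => pd_eq_of_rep hU (ne_zero_of_add_one_le hr) hg hfg c hθ⟩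

theorem IsFunOf.congr {U : Set (Jet n m h)} {V : Set (Coord n m h)} {r : WithTop ℕ∞}
    {f g : JetFun n m h} (hf : IsFunOf U V r f) (hfg : ∀ θ ∈ U, g θ = f θ) : IsFunOf U V r g := by
  obtain ⟨s, hs, k, hk, hfk⟩ := hf
  exact ⟨s, hs, k, hk, fun θ hθ => (hfg θ hθ).trans (hfk θ hθ)⟩

theorem IsFunOf.mono {U : Set (Jet n m h)} {V V' : Set (Coord n m h)} (hV : V ⊆ V')
    {r : WithTop ℕ∞} {f : JetFun n m h} (hf : IsFunOf U V r f) : IsFunOf U V' r f := by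
  obtain ⟨s, hs, k, hk, hfk⟩ := hf
  exact ⟨s, hs.trans hV, k, hk, hfk⟩

/-- A representation by a function of the coordinates from `s` gives one for any larger `s'`. -/
theorem exists_rep_of_subset {U : Set (Jet n m h)} {s s' : Finset (Coord n m h)} (hs : s ⊆ s')
    {r : WithTop ℕ∞} {f : JetFun n m h} {g : (s → ℝ) → ℝ}
    (hg : ContDiffOn ℝ r g (s.restrict '' U)) (hfg : ∀ θ ∈ U, f θ = g (s.restrict θ)) :
    ∃ g' : (s' → ℝ) → ℝ, ContDiffOn ℝ r g' (s'.restrict '' U) ∧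
      ∀ θ ∈ U, f θ = g' (s'.restrict θ) := by
  refine ⟨fun y => g (fun i => y ⟨i, hs i.2⟩), ?_, fun θ hθ => hfg θ hθ⟩
  refine hg.comp (t := s.restrict '' U) (f := fun (y : s' → ℝ) (i : s) => y ⟨i, hs i.2⟩)
    (contDiff_pi.2 fun i => contDiff_apply ℝ ℝ _).contDiffOn ?_
  rintro _ ⟨θ, hθ, rfl⟩
  exact ⟨θ, hθ, rfl⟩

theorem IsFunOf.map₂ {U : Set (Jet n m h)} {V : Set (Coord n m h)} {r : WithTop ℕ∞}
    {f₁ f₂ : JetFun n m h} (hf₁ : IsFunOf U V r f₁) (hf₂ : IsFunOf U V r f₂)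
    {φ : ℝ × ℝ → ℝ} (hφ : ContDiff ℝ r φ) : IsFunOf U V r (fun θ => φ (f₁ θ, f₂ θ)) := by
  obtain ⟨s₁, hs₁, k₁, hk₁, hfk₁⟩ := hf₁
  obtain ⟨s₂, hs₂, k₂, hk₂, hfk₂⟩ := hf₂
  obtain ⟨g₁, hg₁, h₁⟩ := exists_rep_of_subset (Finset.subset_union_left (s₂ := s₂)) hk₁ hfk₁
  obtain ⟨g₂, hg₂, h₂⟩ := exists_rep_of_subset (Finset.subset_union_right (s₁ := s₁)) hk₂ hfk₂
  refine ⟨s₁ ∪ s₂, by simp [hs₁, hs₂], fun y => φ (g₁ y, g₂ y), hφ.comp_contDiffOn (hg₁.prodMk hg₂),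
    fun θ hθ => by simp only [h₁ θ hθ, h₂ θ hθ]⟩

theorem IsFunOf.add {U : Set (Jet n m h)} {V : Set (Coord n m h)} {r : WithTop ℕ∞}
    {f₁ f₂ : JetFun n m h} (hf₁ : IsFunOf U V r f₁) (hf₂ : IsFunOf U V r f₂) :
    IsFunOf U V r (fun θ => f₁ θ + f₂ θ) :=
  hf₁.map₂ hf₂ (φ := fun p => p.1 + p.2) (contDiff_fst.add contDiff_snd)

theorem IsFunOf.mul {U : Set (Jet n m h)} {V : Set (Coord n m h)} {r : WithTop ℕ∞}
    {f₁ f₂ : JetFun n m h} (hf₁ : IsFunOf U V r f₁) (hf₂ : IsFunOf U V r f₂) :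
    IsFunOf U V r (fun θ => f₁ θ * f₂ θ) :=
  hf₁.map₂ hf₂ (φ := fun p => p.1 * p.2) (contDiff_fst.mul contDiff_snd)

theorem IsFunOf.const (U : Set (Jet n m h)) (V : Set (Coord n m h)) (r : WithTop ℕ∞) (a : ℝ) :
    IsFunOf U V r (fun _ => a) :=
  ⟨∅, by simp, fun _ => a, contDiffOn_const, fun _ _ => rfl⟩

theorem IsFunOf.coord (U : Set (Jet n m h)) (r : WithTop ℕ∞) (c : Coord n m h) :
    IsFunOf U Set.univ r (fun θ => θ c) :=
  ⟨{c}, by simp, fun y => y ⟨c, by simp⟩, (contDiff_apply ℝ ℝ _).contDiffOn, fun _ _ => rfl⟩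

theorem IsFunOf.finite_pd {U : Set (Jet n m h)} (hU : IsOpen U) {V : Set (Coord n m h)}
    {r : WithTop ℕ∞} (hr : r ≠ 0) {f : JetFun n m h} (hf : IsFunOf U V r f) :
    ∃ s : Finset (Coord n m h), (s : Set (Coord n m h)) ⊆ V ∧
      ∀ c ∉ s, ∀ θ ∈ U, GenEvol.pd c f θ = 0 := by
  obtain ⟨s, hs, g, hg, hfg⟩ := hf
  refine ⟨s, hs, fun c hc θ hθ => ?_⟩
  rw [pd_eq_of_rep hU hr hg hfg c hθ]
  simp [coordVec, hc]

theorem IsSmooth.pd_comm {U : Set (Jet n m h)} (hU : IsOpen U) {f : JetFun n m h}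
    (hf : IsSmooth U f) (c d : Coord n m h) {θ : Jet n m h} (hθ : θ ∈ U) :
    pd c (pd d f) θ = pd d (pd c f) θ := by
  obtain ⟨s, hs, g, hg, hfg⟩ := hf
  have h1 : (∞ : WithTop ℕ∞) + 1 ≤ ∞ := le_rfl
  have hmem : s.restrict θ ∈ s.restrict '' U := ⟨θ, hθ, rfl⟩
  have hnhds := (isOpen_restrict_image hU s).mem_nhds hmem
  -- Both iterated partials are values of the second Fréchet derivative of one representing
  -- function, whose symmetry gives the claim.
  have key : ∀ a b : Coord n m h, pd a (pd b f) θ =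
      fderiv ℝ (fderiv ℝ g) (s.restrict θ) (coordVec s a) (coordVec s b) := by
    intro a b
    rw [pd_eq_of_rep hU (by simp) (contDiffOn_fderiv_apply hU h1 hg (coordVec s b))
      (fun θ hθ => pd_eq_of_rep hU (by simp) hg hfg b hθ) a hθ]
    have h2 : DifferentiableAt ℝ (fderiv ℝ g) (s.restrict θ) :=
      ((hg.fderiv_of_isOpen (isOpen_restrict_image hU s) h1).differentiableOn
        (by simp)).differentiableAt hnhds
    rw [fderiv_clm_apply h2 (differentiableAt_const _)]
    simp
  rw [key, key]
  exact ((hg.contDiffAt hnhds).isSymmSndFDerivAt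
    (by
      rw [minSmoothness_of_isRCLikeNormedField]
      exact WithTop.coe_le_coe.2 (le_top : (2 : ℕ∞) ≤ ⊤))) _ _

theorem finsum_eq_finsum_comp_of_support_subset_range {α β M : Type*} [AddCommMonoid M]
    {e : α → β} (he : Function.Injective e) {φ : β → M} (hφ : Function.support φ ⊆ Set.range e) :
    ∑ᶠ b, φ b = ∑ᶠ a, φ (e a) := by
  rw [← finsum_mem_range he, ← finsum_mem_univ]
  refine finsum_mem_inter_support_eq' _ _ _ fun x hx => ?_
  simpa using hφ hx

theorem multiindex_induction {P : (Fin n →₀ ℕ) → Prop} (h0 : P 0)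
    (hs : ∀ I j, P I → P (I + Finsupp.single j 1)) (I : Fin n →₀ ℕ) : P I := by
  have key : ∀ (j : Fin n) (b : ℕ) (I : Fin n →₀ ℕ), P I → P (I + Finsupp.single j b) := by
    intro j b
    induction b with
    | zero => intro I hI; simpa using hI
    | succ b ih =>
      intro I hI
      rw [Finsupp.single_add, ← add_assoc]
      exact hs _ _ (ih I hI)
  induction I using Finsupp.induction with
  | zero => exact h0
  | single_add j b f _ _ ih => rw [add_comm]; exact key j b f ih

/-! ### Jet algebras: vector fields and total derivatives, free of smoothness side conditions. -/

/-- An algebra with commuting partial derivatives in the jet coordinates, such that each element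
depends on finitely many of them. -/
structure JetAlgebra (n m h : ℕ) (R : Type*) [CommRing R] [Algebra ℝ R] where
  d : Coord n m h → Derivation ℝ R R
  d_comm : ∀ a b f, d a (d b f) = d b (d a f)
  finite_d : ∀ f, {c | d c f ≠ 0}.Finite
  X : Coord n m h → R
  d_X : ∀ c c', d c (X c') = if c = c' then 1 else 0

namespace JetAlgebra

variable {R : Type*} [CommRing R] [Algebra ℝ R] (Q : JetAlgebra n m h R)

/-- A finite set of coordinates on which `f` depends. -/
def supp (f : R) : Finset (Coord n m h) := (Q.finite_d f).toFinset

theorem d_eq_zero_of_notMem_supp {f : R} {c : Coord n m h} (hc : c ∉ Q.supp f) : Q.d c f = 0 := by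
  simpa [supp] using hc

theorem finsum_mul_d_eq (a : Coord n m h → R) {f : R} {s : Finset (Coord n m h)}
    (hs : ∀ c ∉ s, Q.d c f = 0) : ∑ᶠ c, a c * Q.d c f = ∑ c ∈ s, a c * Q.d c f := by
  refine finsum_eq_sum_of_support_subset _ fun c hc => ?_
  by_contra hcs
  exact hc (by simp [hs c hcs])

/-- The vector field `∑ a_c ∂/∂c`. -/
def vf (a : Coord n m h → R) : Derivation ℝ R R :=
  Derivation.mk'
    { toFun := fun f => ∑ᶠ c, a c * Q.d c f
      map_add' := fun f g => by
        classical
        have hf : ∀ c ∉ Q.supp f ∪ Q.supp g, Q.d c f = 0 := fun c hc =>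
          Q.d_eq_zero_of_notMem_supp fun h' => hc (Finset.mem_union_left _ h')
        have hg : ∀ c ∉ Q.supp f ∪ Q.supp g, Q.d c g = 0 := fun c hc =>
          Q.d_eq_zero_of_notMem_supp fun h' => hc (Finset.mem_union_right _ h')
        have hfg : ∀ c ∉ Q.supp f ∪ Q.supp g, Q.d c (f + g) = 0 := fun c hc => by
          rw [map_add, hf c hc, hg c hc, add_zero]
        rw [Q.finsum_mul_d_eq a hf, Q.finsum_mul_d_eq a hg, Q.finsum_mul_d_eq a hfg,
          ← Finset.sum_add_distrib]
        simp [mul_add]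
      map_smul' := fun r f => by
        have hf : ∀ c ∉ Q.supp f, Q.d c f = 0 := fun c hc => Q.d_eq_zero_of_notMem_supp hc
        have hrf : ∀ c ∉ Q.supp f, Q.d c (r • f) = 0 := fun c hc => by simp [hf c hc]
        rw [Q.finsum_mul_d_eq a hf, Q.finsum_mul_d_eq a hrf, RingHom.id_apply, Finset.smul_sum]
        simp }
    fun f g => by
      classical
      have hf : ∀ c ∉ Q.supp f ∪ Q.supp g, Q.d c f = 0 := fun c hc =>
        Q.d_eq_zero_of_notMem_supp fun h' => hc (Finset.mem_union_left _ h')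
      have hg : ∀ c ∉ Q.supp f ∪ Q.supp g, Q.d c g = 0 := fun c hc =>
        Q.d_eq_zero_of_notMem_supp fun h' => hc (Finset.mem_union_right _ h')
      have hfg : ∀ c ∉ Q.supp f ∪ Q.supp g, Q.d c (f * g) = 0 := fun c hc => by
        rw [Derivation.leibniz, hf c hc, hg c hc, smul_zero, smul_zero, add_zero]
      simp only [LinearMap.coe_mk, AddHom.coe_mk]
      rw [Q.finsum_mul_d_eq a hf, Q.finsum_mul_d_eq a hg, Q.finsum_mul_d_eq a hfg,
        Finset.smul_sum, Finset.smul_sum, ← Finset.sum_add_distrib]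
      refine Finset.sum_congr rfl fun c _ => ?_
      rw [Derivation.leibniz]
      simp only [smul_eq_mul]
      ring

theorem vf_apply (a : Coord n m h → R) (f : R) : Q.vf a f = ∑ᶠ c, a c * Q.d c f := rfl

theorem vf_eq_sum (a : Coord n m h → R) {f : R} {s : Finset (Coord n m h)}
    (hs : ∀ c ∉ s, Q.d c f = 0) : Q.vf a f = ∑ c ∈ s, a c * Q.d c f :=
  Q.finsum_mul_d_eq a hs

theorem vf_add (a b : Coord n m h → R) (f : R) :
    Q.vf (fun c => a c + b c) f = Q.vf a f + Q.vf b f := by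
  have hf : ∀ c ∉ Q.supp f, Q.d c f = 0 := fun c hc => Q.d_eq_zero_of_notMem_supp hc
  rw [Q.vf_eq_sum _ hf, Q.vf_eq_sum _ hf, Q.vf_eq_sum _ hf, ← Finset.sum_add_distrib]
  simp [add_mul]

theorem vf_eq_finsum_comp {ι : Type*} {e : ι → Coord n m h} (he : Function.Injective e)
    {a : Coord n m h → R} (ha : ∀ c, c ∉ Set.range e → a c = 0) (f : R) :
    Q.vf a f = ∑ᶠ p, a (e p) * Q.d (e p) f :=
  finsum_eq_finsum_comp_of_support_subset_range he fun c hc => by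
    by_contra hcr
    exact hc (by simp [ha c hcr])

theorem vf_ite_eq [DecidableEq (Coord n m h)] (c : Coord n m h) (f : R) :
    Q.vf (fun c' => if c' = c then 1 else 0) f = Q.d c f := by
  rw [vf_apply, finsum_eq_single _ c]
  · simp
  · intro c' hc'; simp [hc']

theorem vf_X (a : Coord n m h → R) (c : Coord n m h) : Q.vf a (Q.X c) = a c := by
  rw [vf_apply, finsum_eq_single _ c]
  · simp [Q.d_X]
  · intro c' hc'; simp [Q.d_X, hc']

theorem d_vf (c : Coord n m h) (b : Coord n m h → R) (f : R) :
    Q.d c (Q.vf b f) = Q.vf b (Q.d c f) + Q.vf (fun c' => Q.d c (b c')) f := by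
  have hf : ∀ c ∉ Q.supp f, Q.d c f = 0 := fun c hc => Q.d_eq_zero_of_notMem_supp hc
  have hdf : ∀ c' ∉ Q.supp f, Q.d c' (Q.d c f) = 0 := fun c' hc => by
    rw [Q.d_comm, hf c' hc, map_zero]
  rw [Q.vf_eq_sum _ hf, Q.vf_eq_sum _ hf, Q.vf_eq_sum _ hdf, map_sum, ← Finset.sum_add_distrib]
  refine Finset.sum_congr rfl fun c' _ => ?_
  rw [Derivation.leibniz, Q.d_comm c c']
  simp only [smul_eq_mul]
  ring

/-- The second-order parts of the two compositions agree because the partial derivatives commute, so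
only the action of each field on the other's coefficients has to be compared. -/
theorem vf_comm {a b : Coord n m h → R} (hab : ∀ c, Q.vf a (b c) = Q.vf b (a c)) (f : R) :
    Q.vf a (Q.vf b f) = Q.vf b (Q.vf a f) := by
  have hf : ∀ c ∉ Q.supp f, Q.d c f = 0 := fun c hc => Q.d_eq_zero_of_notMem_supp hc
  have hdf : ∀ c, ∀ c' ∉ Q.supp f, Q.d c' (Q.d c f) = 0 := fun c c' hc => by
    rw [Q.d_comm, hf c' hc, map_zero]
  have key : ∀ a b : Coord n m h → R, Q.vf a (Q.vf b f) =
      ∑ c ∈ Q.supp f, Q.vf a (b c) * Q.d c f +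
        ∑ c ∈ Q.supp f, ∑ c' ∈ Q.supp f, b c * (a c' * Q.d c' (Q.d c f)) := by
    intro a b
    rw [Q.vf_eq_sum b hf, map_sum, ← Finset.sum_add_distrib]
    refine Finset.sum_congr rfl fun c _ => ?_
    rw [Derivation.leibniz, Q.vf_eq_sum a (hdf c), ← Finset.mul_sum]
    simp only [smul_eq_mul]
    ring
  rw [key a b, key b a, Finset.sum_comm (f := fun c c' => b c * (a c' * Q.d c' (Q.d c f)))]
  congr 1
  · exact Finset.sum_congr rfl fun c _ => by rw [hab]
  · refine Finset.sum_congr rfl fun c _ => Finset.sum_congr rfl fun c' _ => ?_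
    rw [Q.d_comm c c']
    ring

/-- The coefficients of the total derivative with respect to `x_j`. -/
def xCoeff (j : Fin n) : Coord n m h → R
  | .t => 0
  | .x i => if i = j then 1 else 0
  | .u k s I => Q.X (.u k s (I + Finsupp.single j 1))

/-- The total derivative with respect to `x_j`. -/
def Dx (j : Fin n) : Derivation ℝ R R := Q.vf (Q.xCoeff j)

theorem Dx_comm (i j : Fin n) (f : R) : Q.Dx i (Q.Dx j f) = Q.Dx j (Q.Dx i f) := by
  refine Q.vf_comm (fun c => ?_) f
  match c with
  | .t => simp [xCoeff]
  | .x k => simp only [xCoeff]; split_ifs <;> simp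
  | .u k s I => simp only [xCoeff, vf_X, add_right_comm]

/-- The iterated total derivative `D_x^I`. -/
def DxI (I : Fin n →₀ ℕ) : R →ₗ[ℝ] R :=
  (List.finRange n).foldr (fun j g => ((Q.Dx j : R →ₗ[ℝ] R) ^ I j).comp g) LinearMap.id

theorem DxI_apply (I : Fin n →₀ ℕ) (f : R) :
    Q.DxI I f = (List.finRange n).foldr (fun j g => (Q.Dx j)^[I j] g) f := by
  unfold DxI
  induction List.finRange n with
  | nil => rfl
  | cons j l ih =>
    simp only [List.foldr_cons, LinearMap.comp_apply, ih, Module.End.pow_apply]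
    rfl

@[simp] theorem DxI_zero (f : R) : Q.DxI 0 f = f := by
  rw [DxI_apply]
  induction List.finRange n with
  | nil => rfl
  | cons j l ih => simp

theorem commute_foldr (P : R → R) (hP : ∀ j f, P (Q.Dx j f) = Q.Dx j (P f)) (I : Fin n →₀ ℕ)
    (l : List (Fin n)) (f : R) :
    P (l.foldr (fun j g => (Q.Dx j)^[I j] g) f) = l.foldr (fun j g => (Q.Dx j)^[I j] g) (P f) := by
  induction l with
  | nil => rfl
  | cons j l ih =>
    simp only [List.foldr_cons]
    rw [← ih]
    exact (Function.Commute.iterate_right (f := P) (g := Q.Dx j) (fun x => hP j x) (I j)) _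

theorem commute_DxI (P : R → R) (hP : ∀ j f, P (Q.Dx j f) = Q.Dx j (P f)) (I : Fin n →₀ ℕ)
    (f : R) : P (Q.DxI I f) = Q.DxI I (P f) := by
  rw [DxI_apply, DxI_apply, Q.commute_foldr P hP]

theorem Dx_DxI (j : Fin n) (I : Fin n →₀ ℕ) (f : R) :
    Q.Dx j (Q.DxI I f) = Q.DxI I (Q.Dx j f) :=
  Q.commute_DxI (Q.Dx j) (fun i f => Q.Dx_comm j i f) I f

theorem DxI_add_single (I : Fin n →₀ ℕ) (j : Fin n) (f : R) :
    Q.DxI (I + Finsupp.single j 1) f = Q.Dx j (Q.DxI I f) := by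
  -- `DxI` composes the derivatives in a fixed order. In a list without repetitions j occurs at most
  -- once, and the extra D_{x_j} moves outwards through the other factors.
  have key : ∀ l : List (Fin n), l.Nodup →
      l.foldr (fun i g => (Q.Dx i)^[(I + Finsupp.single j 1 : Fin n →₀ ℕ) i] g) f =
      if j ∈ l then Q.Dx j (l.foldr (fun i g => (Q.Dx i)^[I i] g) f)
      else l.foldr (fun i g => (Q.Dx i)^[I i] g) f := by
    intro l hl
    induction l with
    | nil => simp
    | cons i l ih =>
      rw [List.nodup_cons] at hl
      simp only [List.foldr_cons]
      rw [ih hl.2]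
      by_cases hij : i = j
      · subst hij
        simp only [hl.1, if_false, List.mem_cons, true_or, if_true, Finsupp.add_apply,
          Finsupp.single_eq_same]
        rw [Function.iterate_succ_apply']
      · have hji : j ≠ i := Ne.symm hij
        simp only [Finsupp.add_apply, Finsupp.single_eq_of_ne hij, add_zero, List.mem_cons, hji,
          false_or]
        split_ifs
        · exact ((Function.Commute.iterate_right (f := Q.Dx j) (g := Q.Dx i)
            (fun x => Q.Dx_comm j i x) (I i)) _).symm
        · rfl
  rw [DxI_apply, DxI_apply, key _ (List.nodup_finRange n), if_pos (List.mem_finRange j)]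

/-- The coefficients of the total derivative with respect to `t`. -/
def tCoeff (F : Fin m → R) : Coord n m h → R
  | .t => 1
  | .x _ => 0
  | .u k s I => if hs : (s : ℕ) + 1 < h then Q.X (.u k ⟨s + 1, hs⟩ I) else Q.DxI I (F k)

/-- The total derivative with respect to `t` for the system `∂^h u^i / ∂t^h = F^i`. -/
def Dt (F : Fin m → R) : Derivation ℝ R R := Q.vf (Q.tCoeff F)

theorem Dt_Dx (F : Fin m → R) (j : Fin n) (f : R) :
    Q.Dt F (Q.Dx j f) = Q.Dx j (Q.Dt F f) := by
  refine Q.vf_comm (fun c => ?_) f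
  match c with
  | .t => simp [xCoeff, tCoeff]
  | .x k => simp only [xCoeff, tCoeff, map_zero]; split_ifs <;> simp
  | .u k s I =>
    simp only [xCoeff, tCoeff, vf_X]
    split_ifs
    · simp only [vf_X, xCoeff]
    -- At level h - 1 commutation reduces to D_x^{I+1_j} F = D_{x_j} D_x^I F.
    · exact Q.DxI_add_single I j (F k)

theorem Dt_DxI (F : Fin m → R) (I : Fin n →₀ ℕ) (f : R) :
    Q.Dt F (Q.DxI I f) = Q.DxI I (Q.Dt F f) :=
  Q.commute_DxI (Q.Dt F) (fun j f => Q.Dt_Dx F j f) I f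

/-- The partial derivative with respect to `u^i_{s,I}`, and zero if `s ≥ h`. -/
def du (i : Fin m) (s : ℕ) (I : Fin n →₀ ℕ) : Derivation ℝ R R :=
  if hs : s < h then Q.d (.u i ⟨s, hs⟩ I) else 0

theorem du_of_lt (i : Fin m) {s : ℕ} (hs : s < h) (I : Fin n →₀ ℕ) :
    Q.du i s I = Q.d (.u i ⟨s, hs⟩ I) := dif_pos hs

theorem du_of_le (i : Fin m) {s : ℕ} (hs : h ≤ s) (I : Fin n →₀ ℕ) (f : R) :
    Q.du i s I f = 0 := by
  rw [du, dif_neg hs.not_gt]; rfl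

theorem finite_du (i : Fin m) (s : ℕ) (f : R) : {I | Q.du i s I f ≠ 0}.Finite := by
  by_cases hs : s < h
  · simp_rw [du_of_lt Q i hs]
    exact (Q.finite_d f).preimage (f := fun I => Coord.u i ⟨s, hs⟩ I)
      (Function.Injective.injOn fun I J h => by simpa using h)
  · simp [du_of_le Q i (not_lt.1 hs)]

theorem finite_du_pair (s : ℕ) (f : R) :
    {p : Fin m × (Fin n →₀ ℕ) | Q.du p.1 s p.2 f ≠ 0}.Finite := by
  have : {p : Fin m × (Fin n →₀ ℕ) | Q.du p.1 s p.2 f ≠ 0} ⊆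
      ⋃ i : Fin m, (fun I => (i, I)) '' {I | Q.du i s I f ≠ 0} := by
    rintro ⟨i, I⟩ hp
    exact Set.mem_iUnion.2 ⟨i, I, hp, rfl⟩
  exact (Set.finite_iUnion fun i => (Q.finite_du i s f).image _).subset this

/-- This is the commutator of ∂/∂u_{s,I} with D_{x_j}: the only coefficient of D_{x_j} involving
u_{s,I} is the one at ∂/∂u_{s,I-1_j}, which exists only if I_j ≠ 0. -/
theorem d_x_coeff (i : Fin m) (s : Fin h) (I : Fin n →₀ ℕ) (j : Fin n) (f : R) :
    Q.vf (fun c => Q.d (.u i s I) (Q.xCoeff j c)) f =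
      if I j ≠ 0 then Q.d (.u i s (I - Finsupp.single j 1)) f else 0 := by
  split_ifs with hI
  · rw [← Q.vf_ite_eq]
    congr 2
    ext c
    match c with
    | .t => simp [xCoeff]
    | .x k => by_cases hk : k = j <;> simp [xCoeff, hk]
    | .u k s' I' =>
      simp only [xCoeff, Q.d_X, Coord.u.injEq]
      refine if_congr ?_ rfl rfl
      constructor
      · rintro ⟨rfl, rfl, rfl⟩
        simp
      · rintro ⟨rfl, rfl, rfl⟩
        refine ⟨rfl, rfl, (tsub_add_cancel_of_le ?_).symm⟩
        exact Finsupp.single_le_iff.2 (Nat.one_le_iff_ne_zero.2 hI)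
  · have : (fun c => Q.d (.u i s I) (Q.xCoeff j c)) = 0 := by
      ext c
      match c with
      | .t => simp [xCoeff]
      | .x k => simp only [xCoeff]; split_ifs <;> simp
      | .u k s' I' =>
        simp only [xCoeff, Q.d_X, Coord.u.injEq, Pi.zero_apply, ite_eq_right_iff]
        rintro ⟨rfl, rfl, rfl⟩
        simp at hI
    rw [this, vf_apply]
    simp

theorem du_Dx (i : Fin m) (s : ℕ) (I : Fin n →₀ ℕ) (j : Fin n) (f : R) :
    Q.du i s I (Q.Dx j f) = Q.Dx j (Q.du i s I f) +
      if I j ≠ 0 then Q.du i s (I - Finsupp.single j 1) f else 0 := by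
  by_cases hs : s < h
  · simp_rw [du_of_lt Q i hs]
    rw [Dx, d_vf, d_x_coeff]
  · simp [du_of_le Q i (not_lt.1 hs)]

/-! ### Euler operators and the adjoint linearized equation. -/

/-- The operator `(-D)_x^I`. -/
def nDxI (I : Fin n →₀ ℕ) : R →ₗ[ℝ] R := (-1 : ℝ) ^ I.degree • Q.DxI I

@[simp] theorem nDxI_zero (f : R) : Q.nDxI 0 f = f := by simp [nDxI]

theorem nDxI_add_single (I : Fin n →₀ ℕ) (j : Fin n) (f : R) :
    Q.nDxI (I + Finsupp.single j 1) f = Q.nDxI I (-(Q.Dx j f)) := by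
  simp [nDxI, Q.DxI_add_single, Q.Dx_DxI, pow_succ]

/-- The expression `∑_I (-D)_x^I (∂G/∂u^i_{s,I} · g)`. -/
def euler (i : Fin m) (s : ℕ) (G g : R) : R := ∑ᶠ I, Q.nDxI I (Q.du i s I G * g)

theorem finite_support_euler (i : Fin m) (s : ℕ) (G g : R) :
    (Function.support fun I => Q.nDxI I (Q.du i s I G * g)).Finite :=
  (Q.finite_du i s G).subset fun I hI hG => hI (by simp [hG])

theorem euler_eq_sum (i : Fin m) (s : ℕ) {G : R} (g : R) {B : Finset (Fin n →₀ ℕ)}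
    (hB : ∀ I ∉ B, Q.du i s I G = 0) :
    Q.euler i s G g = ∑ I ∈ B, Q.nDxI I (Q.du i s I G * g) := by
  refine finsum_eq_sum_of_support_subset _ fun I hI => ?_
  by_contra hIB
  exact hI (by simp [hB I hIB])

theorem euler_add_left (i : Fin m) (s : ℕ) (G G' g : R) :
    Q.euler i s (G + G') g = Q.euler i s G g + Q.euler i s G' g := by
  unfold euler
  rw [← finsum_add_distrib (Q.finite_support_euler i s G g) (Q.finite_support_euler i s G' g)]
  simp [add_mul]

theorem euler_zero_left (i : Fin m) (s : ℕ) (g : R) : Q.euler i s 0 g = 0 := by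
  simp [euler]

theorem euler_sum_left {ι : Type*} (i : Fin m) (s : ℕ) (T : Finset ι) (G : ι → R) (g : R) :
    Q.euler i s (∑ k ∈ T, G k) g = ∑ k ∈ T, Q.euler i s (G k) g := by
  classical
  induction T using Finset.induction with
  | empty => simp [euler_zero_left]
  | insert a T ha ih => rw [Finset.sum_insert ha, Finset.sum_insert ha, euler_add_left, ih]

theorem euler_sum_right {ι : Type*} (i : Fin m) (s : ℕ) (T : Finset ι) (G : R) (g : ι → R) :
    Q.euler i s G (∑ k ∈ T, g k) = ∑ k ∈ T, Q.euler i s G (g k) := by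
  have hB : ∀ I ∉ (Q.finite_du i s G).toFinset, Q.du i s I G = 0 := fun I hI => by simpa using hI
  simp_rw [Q.euler_eq_sum i s _ hB, Finset.mul_sum, map_sum]
  exact Finset.sum_comm

/-- Integration by parts. In the commutator terms ∂G/∂u_{s,I-1_j}, shifting I by 1_j produces an
additional -D_{x_j} acting on a product. One half of its Leibniz expansion cancels the terms with
D_{x_j}(∂G/∂u_{s,I}), the other half is the right-hand side. For g = 1 the result is zero, so
x-divergences are annihilated. -/
theorem euler_Dx (i : Fin m) (s : ℕ) (j : Fin n) (G g : R) :
    Q.euler i s (Q.Dx j G) g = Q.euler i s G (-(Q.Dx j g)) := by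
  have hinj : Function.Injective fun I : Fin n →₀ ℕ => I + Finsupp.single j 1 :=
    add_left_injective _
  have h1 : ∑ᶠ I : Fin n →₀ ℕ, Q.nDxI I
      ((if I j ≠ 0 then Q.du i s (I - Finsupp.single j 1) G else 0) * g) =
      ∑ᶠ I, Q.nDxI I (-(Q.Dx j (Q.du i s I G)) * g + Q.du i s I G * -(Q.Dx j g)) := by
    rw [finsum_eq_finsum_comp_of_support_subset_range hinj]
    · refine finsum_congr fun I => ?_
      rw [nDxI_add_single]
      simp [Derivation.leibniz]
      ring_nf
    · intro I hI
      by_cases hj : I j = 0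
      · exact absurd (by simp [hj]) hI
      · exact ⟨I - Finsupp.single j 1, tsub_add_cancel_of_le
          (Finsupp.single_le_iff.2 (Nat.one_le_iff_ne_zero.2 hj))⟩
  have hfin1 : (Function.support fun I => Q.nDxI I (Q.Dx j (Q.du i s I G) * g)).Finite :=
    (Q.finite_du i s G).subset fun I hI hG => hI (by simp [hG])
  have hfin2 : (Function.support fun I => Q.nDxI I (-(Q.Dx j (Q.du i s I G)) * g)).Finite :=
    (Q.finite_du i s G).subset fun I hI hG => hI (by simp [hG])
  have hfin3 : (Function.support fun I : Fin n →₀ ℕ => Q.nDxI I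
      ((if I j ≠ 0 then Q.du i s (I - Finsupp.single j 1) G else 0) * g)).Finite := by
    refine ((Q.finite_du i s G).image fun I => I + Finsupp.single j 1).subset fun I hI => ?_
    by_cases hj : I j = 0
    · exact absurd (by simp [hj]) hI
    · refine ⟨I - Finsupp.single j 1, fun hG => hI (by simp [hG]), tsub_add_cancel_of_le
          (Finsupp.single_le_iff.2 (Nat.one_le_iff_ne_zero.2 hj))⟩
  have hfin4 : (Function.support fun I => Q.nDxI I (Q.du i s I G * -(Q.Dx j g))).Finite :=
    Q.finite_support_euler i s G _
  unfold euler
  simp_rw [du_Dx, add_mul, map_add]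
  rw [finsum_add_distrib hfin1 hfin3, h1]
  simp_rw [map_add]
  rw [finsum_add_distrib hfin2 hfin4, ← add_assoc, ← finsum_add_distrib hfin1 hfin2]
  simp

theorem euler_DxI (i : Fin m) (s : ℕ) (J : Fin n →₀ ℕ) (G g : R) :
    Q.euler i s (Q.DxI J G) g = Q.euler i s G (Q.nDxI J g) := by
  induction J using multiindex_induction generalizing g with
  | h0 => simp
  | hs J j ih => rw [DxI_add_single, euler_Dx, ih, ← nDxI_add_single]

/-- The partial derivative with respect to `u^i_{s-1,I}`, and zero if `s = 0`. -/
def duPred (i : Fin m) (s : ℕ) (I : Fin n →₀ ℕ) (f : R) : R :=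
  if s = 0 then 0 else Q.du i (s - 1) I f

/-- The commutator of ∂/∂u_{s,I} with D_t comes from differentiating the coefficients of D_t:
u_{s,I} itself is the coefficient at level s - 1, and the functions D_x^J F^k are the coefficients
at level h - 1. -/
theorem du_Dt (F : Fin m → R) (i : Fin m) {s : ℕ} (hs : s < h) (I : Fin n →₀ ℕ) (f : R) :
    Q.du i s I (Q.Dt F f) = Q.Dt F (Q.du i s I f) + Q.duPred i s I f +
      ∑ᶠ p : Fin m × (Fin n →₀ ℕ), Q.du i s I (Q.DxI p.2 (F p.1)) * Q.du p.1 (h - 1) p.2 f := by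
  have hh : h - 1 < h := by omega
  -- The fields `a` and `b` collect these two contributions.
  let a : Coord n m h → R := fun c => if s ≠ 0 ∧ c = .u i ⟨s - 1, by omega⟩ I then 1 else 0
  let b : Coord n m h → R := fun c => match c with
    | .u k s' I' => if (s' : ℕ) + 1 < h then 0 else Q.du i s I (Q.DxI I' (F k))
    | _ => 0
  have hab : (fun c => Q.du i s I (Q.tCoeff F c)) = fun c => a c + b c := by
    ext c
    match c with
    | .t => simp [tCoeff, a, b]
    | .x k => simp [tCoeff, a, b]
    | .u k s' I' =>
      simp only [tCoeff, a, b]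
      split_ifs with h1 h2 h2
      · obtain ⟨h3, h4⟩ := h2
        rw [Coord.u.injEq] at h4
        obtain ⟨rfl, rfl, rfl⟩ := h4
        rw [du_of_lt Q _ hs, Q.d_X, if_pos, add_zero]
        simp only [Coord.u.injEq, Fin.mk.injEq, true_and, and_true]
        omega
      · rw [du_of_lt Q _ hs, Q.d_X, if_neg, add_zero]
        simp only [Coord.u.injEq, Fin.mk.injEq]
        rintro ⟨rfl, rfl, rfl⟩
        exact h2 ⟨by simp, by simp⟩
      · obtain ⟨h3, h4⟩ := h2
        rw [Coord.u.injEq] at h4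
        obtain ⟨rfl, rfl, rfl⟩ := h4
        simp at h1
        omega
      · simp
  have ha : Q.vf a f = Q.duPred i s I f := by
    unfold duPred
    split_ifs with h0
    · have : a = 0 := by ext c; simp [a, h0]
      rw [this, vf_apply]
      simp
    · rw [du_of_lt Q i (by omega : s - 1 < h), ← Q.vf_ite_eq]
      congr 2
      ext c
      simp [a, h0]
  have hb : Q.vf b f = ∑ᶠ p : Fin m × (Fin n →₀ ℕ),
      Q.du i s I (Q.DxI p.2 (F p.1)) * Q.du p.1 (h - 1) p.2 f := by
    rw [Q.vf_eq_finsum_comp (e := fun p : Fin m × (Fin n →₀ ℕ) => Coord.u p.1 ⟨h - 1, hh⟩ p.2)]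
    · refine finsum_congr fun p => ?_
      have : ¬ (h - 1 + 1 < h) := by omega
      simp only [b, this, if_false]
      rw [Q.du_of_lt p.1 hh]
    · rintro ⟨k, J⟩ ⟨k', J'⟩ hp
      simpa using hp
    · intro c hc
      match c with
      | .t => rfl
      | .x k => rfl
      | .u k s' I' =>
        simp only [b, ite_eq_left_iff]
        intro hs'
        refine absurd ⟨(k, I'), ?_⟩ hc
        have : s' = ⟨h - 1, hh⟩ := Fin.ext (by have := s'.2; simp only; omega)
        rw [this]
  rw [add_assoc, ← ha, ← hb, ← vf_add, ← hab, du_of_lt Q i hs, Dt, d_vf]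

/-- The Euler derivatives of `Dt f` in terms of those of `f`. -/
theorem euler_Dt (F : Fin m → R) (i : Fin m) {s : ℕ} (hs : s < h) (f : R) :
    Q.euler i s (Q.Dt F f) 1 = Q.Dt F (Q.euler i s f 1) +
      (if s = 0 then 0 else Q.euler i (s - 1) f 1) +
      ∑ k, Q.euler i s (F k) (Q.euler k (h - 1) f 1) := by
  have hfin1 : (Function.support fun I => Q.nDxI I (Q.Dt F (Q.du i s I f))).Finite :=
    (Q.finite_du i s f).subset fun I hI hG => hI (by simp [hG])
  have hfin2 : (Function.support fun I => Q.nDxI I (Q.duPred i s I f)).Finite :=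
    (Q.finite_du i (s - 1) f).subset fun I hI hG => hI (by simp [duPred, hG])
  -- A finite set of indices independent of I, which allows the two summations to be interchanged.
  set S := (Q.finite_du_pair (h - 1) f).toFinset with hS
  have hS' : ∀ p ∉ S, Q.du p.1 (h - 1) p.2 f = 0 := fun p hp => by simpa [hS] using hp
  have hsum : ∀ I, ∑ᶠ p : Fin m × (Fin n →₀ ℕ),
      Q.du i s I (Q.DxI p.2 (F p.1)) * Q.du p.1 (h - 1) p.2 f =
      ∑ p ∈ S, Q.du i s I (Q.DxI p.2 (F p.1)) * Q.du p.1 (h - 1) p.2 f := fun I =>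
    finsum_eq_sum_of_support_subset _ fun p hp => by
      by_contra hpS
      exact hp (by simp [hS' p hpS])
  have hfin3 : ∀ p ∈ S, (Function.support fun I =>
      Q.nDxI I (Q.du i s I (Q.DxI p.2 (F p.1)) * Q.du p.1 (h - 1) p.2 f)).Finite :=
    fun p _ => Q.finite_support_euler i s _ _
  have hfin3' : (Function.support fun I =>
      ∑ p ∈ S, Q.nDxI I (Q.du i s I (Q.DxI p.2 (F p.1)) * Q.du p.1 (h - 1) p.2 f)).Finite := by
    refine (S.finite_toSet.biUnion hfin3).subset fun I hI => ?_
    obtain ⟨p, hp, hpI⟩ := Finset.exists_ne_zero_of_sum_ne_zero hI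
    exact Set.mem_biUnion hp hpI
  have e1 : Q.euler i s (Q.Dt F f) 1 = ∑ᶠ I, (Q.nDxI I (Q.Dt F (Q.du i s I f)) +
      Q.nDxI I (Q.duPred i s I f) +
      ∑ p ∈ S, Q.nDxI I (Q.du i s I (Q.DxI p.2 (F p.1)) * Q.du p.1 (h - 1) p.2 f)) := by
    unfold euler
    simp_rw [Q.du_Dt F i hs, hsum, mul_one, map_add, map_sum]
  have e2 : ∑ᶠ I, Q.nDxI I (Q.Dt F (Q.du i s I f)) = Q.Dt F (Q.euler i s f 1) := by
    have hB : ∀ I ∉ (Q.finite_du i s f).toFinset, Q.du i s I f = 0 := fun I hI => by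
      simpa using hI
    rw [Q.euler_eq_sum i s 1 hB, map_sum]
    rw [finsum_eq_sum_of_support_subset (s := (Q.finite_du i s f).toFinset)]
    · refine Finset.sum_congr rfl fun I _ => ?_
      simp [nDxI, Q.Dt_DxI]
    · intro I hI
      by_contra hIB
      exact hI (by simp [hB I hIB])
  have e3 : ∑ᶠ I, Q.nDxI I (Q.duPred i s I f) = if s = 0 then 0 else Q.euler i (s - 1) f 1 := by
    unfold duPred euler
    split_ifs
    · simp
    · simp
  rw [e1, finsum_add_distrib ((hfin1.union hfin2).subset (Function.support_add _ _)) hfin3',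
    finsum_add_distrib hfin1 hfin2, e2, e3, finsum_sum_comm _ _ hfin3]
  congr 1
  have e4 : ∀ k, Q.euler k (h - 1) f 1 =
      ∑ J ∈ S.image Prod.snd, Q.nDxI J (Q.du k (h - 1) J f) := by
    intro k
    classical
    rw [Q.euler_eq_sum k (h - 1) 1 (B := S.image Prod.snd)]
    · simp
    · intro J hJ
      exact hS' (k, J) fun hm => hJ (Finset.mem_image.2 ⟨_, hm, rfl⟩)
  -- By `euler_DxI` the D_x^J applied to F^k passes to the factor ∂f/∂u^k_{h-1,J} as (-D_x)^J.
  -- Summed over J, these are the Euler derivatives of f at level h - 1.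
  simp_rw [e4, euler_sum_right, ← euler_DxI]
  rw [← Finset.sum_product']
  refine Finset.sum_subset (fun p hp => ?_) fun p _ hp => ?_
  · exact Finset.mem_product.2 ⟨Finset.mem_univ _, Finset.mem_image.2 ⟨p, hp, rfl⟩⟩
  · simp [hS' p hp]

/-- The adjoint linearized equation for the characteristic of a conserved current. -/
theorem iterate_neg_Dt_euler (F : Fin m → R) (hh : 0 < h) (i : Fin m) (f : R)
    (hf : ∀ s < h, Q.euler i s (Q.Dt F f) 1 = 0) :
    (-1 : ℝ) ^ h • (Q.Dt F)^[h] (Q.euler i (h - 1) f 1) =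
      ∑ s ∈ Finset.range h, (-1 : ℝ) ^ s • (Q.Dt F)^[s]
        (∑ k, Q.euler i s (F k) (Q.euler k (h - 1) f 1)) := by
  -- With the index shifted by one, ψ 0 = 0 and ψ h is the Euler derivative at level h - 1. The
  -- equation at level s reads ∑_k (…) = -D_t ψ(s+1) - ψ(s), and (-D_t)^s makes it a difference of
  -- consecutive terms.
  let ψ : ℕ → R := fun s => if s = 0 then 0 else Q.euler i (s - 1) f 1
  have hlin : ∀ s, ⇑((Q.Dt F : R →ₗ[ℝ] R) ^ s) = (Q.Dt F)^[s] := fun s => by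
    ext x; rw [Module.End.pow_apply]; rfl
  have key : ∀ s ∈ Finset.range h, (-1 : ℝ) ^ s • (Q.Dt F)^[s]
      (∑ k, Q.euler i s (F k) (Q.euler k (h - 1) f 1)) =
      (-1 : ℝ) ^ (s + 1) • (Q.Dt F)^[s + 1] (ψ (s + 1)) - (-1 : ℝ) ^ s • (Q.Dt F)^[s] (ψ s) := by
    intro s hs
    have h1 := Q.euler_Dt F i (Finset.mem_range.1 hs) f
    rw [hf s (Finset.mem_range.1 hs)] at h1
    have h2 : ∑ k, Q.euler i s (F k) (Q.euler k (h - 1) f 1) =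
        -(Q.Dt F (ψ (s + 1))) - ψ s := by
      simp only [ψ, Nat.add_eq_zero_iff, one_ne_zero, and_false, if_false, Nat.add_sub_cancel]
      linear_combination -h1
    rw [h2, Function.iterate_succ_apply, ← hlin, map_sub, map_neg, pow_succ]
    simp [smul_sub]
  rw [Finset.sum_congr rfl key,
    Finset.sum_range_sub (fun s => (-1 : ℝ) ^ s • (Q.Dt F)^[s] (ψ s))]
  simp [ψ, hh.ne']

end JetAlgebra

/-! ### Combinatorics of multi-indices. -/

theorem sum_antidiagonal_swap {M : Type*} [AddCommMonoid M] (I : Fin n →₀ ℕ)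
    (φ : (Fin n →₀ ℕ) × (Fin n →₀ ℕ) → M) :
    ∑ p ∈ Finset.HasAntidiagonal.antidiagonal I, φ p.swap =
      ∑ p ∈ Finset.HasAntidiagonal.antidiagonal I, φ p :=
  Finset.sum_equiv (Equiv.prodComm _ _) (fun p => by simp [add_comm]) fun _ _ => rfl

/-- The decompositions of I + 1_j missed by the shift are those with first part vanishing at j,
where φ is zero. -/
theorem sum_antidiagonal_add_single {M : Type*} [AddCommMonoid M] (I : Fin n →₀ ℕ) (j : Fin n)
    (φ : (Fin n →₀ ℕ) × (Fin n →₀ ℕ) → M) (hφ : ∀ p, p.1 j = 0 → φ p = 0) :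
    ∑ p ∈ Finset.HasAntidiagonal.antidiagonal I, φ (p.1 + Finsupp.single j 1, p.2) =
      ∑ p ∈ Finset.HasAntidiagonal.antidiagonal (I + Finsupp.single j 1), φ p := by
  refine Finset.sum_of_injOn (fun p => (p.1 + Finsupp.single j 1, p.2)) ?_ ?_ ?_ fun _ _ => rfl
  · rintro ⟨a, b⟩ - ⟨a', b'⟩ - hab
    simpa using hab
  · rintro ⟨a, b⟩ hab
    simp only [Finset.mem_coe, Finset.HasAntidiagonal.mem_antidiagonal] at hab ⊢
    rw [← hab, add_right_comm]
  · rintro ⟨a, b⟩ hab hnot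
    refine hφ _ ?_
    by_contra ha
    refine hnot ⟨(a - Finsupp.single j 1, b), ?_, ?_⟩
    · have h1 : a - Finsupp.single j 1 + Finsupp.single j 1 = a := tsub_add_cancel_of_le
          (Finsupp.single_le_iff.2 (Nat.one_le_iff_ne_zero.2 ha))
      simp only [Finset.mem_coe, Finset.HasAntidiagonal.mem_antidiagonal] at hab ⊢
      rw [← h1, add_right_comm] at hab
      exact add_right_cancel hab
    · simp only [Prod.mk.injEq, and_true]
      exact tsub_add_cancel_of_le (Finsupp.single_le_iff.2 (Nat.one_le_iff_ne_zero.2 ha))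

/-- The multi-index factorial. -/
def multiFactorial (I : Fin n →₀ ℕ) : ℝ := ∏ l, ((I l).factorial : ℝ)

theorem multiFactorial_ne_zero (I : Fin n →₀ ℕ) : multiFactorial I ≠ 0 :=
  Finset.prod_ne_zero_iff.2 fun _ _ => Nat.cast_ne_zero.2 (Nat.factorial_ne_zero _)

theorem multiFactorial_add_single (I : Fin n →₀ ℕ) (j : Fin n) :
    multiFactorial (I + Finsupp.single j 1) = (I j + 1 : ℝ) * multiFactorial I := by
  have h1 : ∀ l, (((I + Finsupp.single j 1 : Fin n →₀ ℕ) l).factorial : ℝ) =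
      (if l = j then (I j + 1 : ℝ) else 1) * (I l).factorial := by
    intro l
    by_cases hl : l = j
    · subst hl; simp [Nat.factorial_succ]
    · simp [hl]
  simp only [multiFactorial, h1, Finset.prod_mul_distrib, Finset.prod_ite_eq', Finset.mem_univ,
    if_true]

theorem prod_choose_mul_multiFactorial (J K : Fin n →₀ ℕ) :
    (∏ l, ((J l + K l).choose (J l) : ℝ)) * (multiFactorial J * multiFactorial K) =
      multiFactorial (J + K) := by
  simp only [multiFactorial, ← Finset.prod_mul_distrib]
  refine Finset.prod_congr rfl fun l _ => ?_
  have := Nat.add_choose_mul_factorial_mul_factorial (J l) (K l)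
  rw [← Nat.choose_symm_add] at this
  rw [Finsupp.add_apply, ← this]
  push_cast
  ring

/-- The set of multi-indices of degree at most `N`. -/
def degreeLE (n N : ℕ) : Finset (Fin n →₀ ℕ) :=
  (Finset.range (N + 1)).biUnion fun d => Finset.finsuppAntidiag Finset.univ d

theorem mem_finsuppAntidiag_univ {I : Fin n →₀ ℕ} {d : ℕ} :
    I ∈ Finset.finsuppAntidiag (Finset.univ : Finset (Fin n)) d ↔ I.degree = d := by
  rw [Finset.mem_finsuppAntidiag, Finsupp.degree_eq_sum]
  simp

@[simp] theorem mem_degreeLE {N : ℕ} {I : Fin n →₀ ℕ} : I ∈ degreeLE n N ↔ I.degree ≤ N := by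
  simp only [degreeLE, Finset.mem_biUnion, Finset.mem_range, mem_finsuppAntidiag_univ]
  constructor
  · rintro ⟨a, ha, rfl⟩; omega
  · intro hI; exact ⟨_, by omega, rfl⟩

theorem sum_degreeLE_sum_antidiagonal {M : Type*} [AddCommMonoid M] (N : ℕ)
    (φ : (Fin n →₀ ℕ) × (Fin n →₀ ℕ) → M) (hφ : ∀ p, N < (p.1 + p.2).degree → φ p = 0) :
    ∑ I ∈ degreeLE n N, ∑ p ∈ Finset.HasAntidiagonal.antidiagonal I, φ p =
      ∑ J ∈ degreeLE n N, ∑ K ∈ degreeLE n N, φ (J, K) := by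
  rw [← Finset.sum_product', ← Finset.sum_filter_add_sum_filter_not (degreeLE n N ×ˢ degreeLE n N)
    (fun p => p.1 + p.2 ∈ degreeLE n N), Finset.sum_eq_zero
    (s := Finset.filter (fun p : (Fin n →₀ ℕ) × (Fin n →₀ ℕ) => p.1 + p.2 ∉ degreeLE n N) _),
    add_zero]
  · refine Eq.trans ?_ (Finset.sum_fiberwise_of_maps_to
      (g := fun p : (Fin n →₀ ℕ) × (Fin n →₀ ℕ) => p.1 + p.2) (t := degreeLE n N) ?_ _)
    · refine Finset.sum_congr rfl fun I hI => Finset.sum_congr ?_ fun _ _ => rfl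
      ext ⟨J, K⟩
      simp only [Finset.HasAntidiagonal.mem_antidiagonal, Finset.mem_filter,
        Finset.mem_product, mem_degreeLE]
      constructor
      · rintro rfl
        simp only [mem_degreeLE, map_add] at hI
        simp only [map_add, and_true]
        omega
      · rintro ⟨-, h⟩
        exact h
    · intro p hp
      exact (Finset.mem_filter.1 hp).2
  · intro p hp
    refine hφ p ?_
    simpa using (Finset.mem_filter.1 hp).2

theorem sum_ite_le_eq_sum_antidiagonal {M : Type*} [AddCommMonoid M] (K : Fin n →₀ ℕ) (a : ℕ)
    (ψ : (Fin n →₀ ℕ) → (Fin n →₀ ℕ) → M) {B : Finset (Fin n →₀ ℕ)}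
    (hB : ∀ J ≤ K, J.degree = a → J ∈ B) :
    ∑ J ∈ B, (if J ≤ K ∧ J.degree = a then ψ J (K - J) else 0) =
      ∑ p ∈ Finset.HasAntidiagonal.antidiagonal K, if p.1.degree = a then ψ p.1 p.2 else 0 := by
  rw [← Finset.sum_filter, ← Finset.sum_filter]
  refine Finset.sum_nbij' (fun J => (J, K - J)) Prod.fst ?_ ?_ ?_ ?_ ?_
  · intro J hJ
    simp only [Finset.mem_filter, Finset.HasAntidiagonal.mem_antidiagonal] at hJ ⊢
    exact ⟨add_tsub_cancel_of_le hJ.2.1, hJ.2.2⟩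
  · rintro ⟨J, L⟩ hp
    simp only [Finset.mem_filter, Finset.HasAntidiagonal.mem_antidiagonal] at hp ⊢
    have hJ : J ≤ K := hp.1 ▸ le_self_add
    exact ⟨hB J hJ hp.2, hJ, hp.2⟩
  · intro J _; rfl
  · rintro ⟨J, L⟩ hp
    simp only [Finset.mem_filter, Finset.HasAntidiagonal.mem_antidiagonal] at hp
    simp [← hp.1]
  · intro J _; rfl

/-! ### Leibniz rules and the coefficients of the adjoint operator. -/

namespace JetAlgebra

variable {R : Type*} [CommRing R] [Algebra ℝ R] (Q : JetAlgebra n m h R)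

theorem inv_multiFactorial_smul_Dx (I : Fin n →₀ ℕ) (j : Fin n) (f : R) :
    (multiFactorial I)⁻¹ • Q.Dx j (Q.DxI I f) =
      (I j + 1 : ℝ) • (multiFactorial (I + Finsupp.single j 1))⁻¹ •
        Q.DxI (I + Finsupp.single j 1) f := by
  rw [DxI_add_single, multiFactorial_add_single, smul_smul]
  congr 1
  have h1 : (I j + 1 : ℝ) ≠ 0 := by positivity
  field_simp

/-- The Leibniz rule in terms of divided derivatives. -/
theorem divided_leibniz (I : Fin n →₀ ℕ) (f g : R) :
    (multiFactorial I)⁻¹ • Q.DxI I (f * g) = ∑ p ∈ Finset.HasAntidiagonal.antidiagonal I,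
      ((multiFactorial p.1)⁻¹ • Q.DxI p.1 f) * ((multiFactorial p.2)⁻¹ • Q.DxI p.2 g) := by
  induction I using multiindex_induction with
  | h0 => simp [multiFactorial]
  | hs I j ih =>
    have h1 : (I j + 1 : ℝ) ≠ 0 := by positivity
    have h2 := congrArg (Q.Dx j) ih
    rw [Derivation.map_smul, inv_multiFactorial_smul_Dx, map_sum] at h2
    -- For divided derivatives e_J one has D_{x_j} e_J = (J_j + 1) e_{J+1_j}. After both halves of
    -- the Leibniz rule are shifted to decompositions of I + 1_j, their weights add up to p.1_j +
    -- p.2_j = I_j + 1, a common factor that is cancelled at the end.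
    have h3 : ∀ e : (Fin n →₀ ℕ) → R → R,
        (∀ J f, Q.Dx j (e J f) = (J j + 1 : ℝ) • e (J + Finsupp.single j 1) f) →
        ∑ p ∈ Finset.HasAntidiagonal.antidiagonal I, Q.Dx j (e p.1 f * e p.2 g) =
        (I j + 1 : ℝ) • ∑ p ∈ Finset.HasAntidiagonal.antidiagonal (I + Finsupp.single j 1),
          e p.1 f * e p.2 g := by
      intro e he
      have h4 : ∀ p ∈ Finset.HasAntidiagonal.antidiagonal I, Q.Dx j (e p.1 f * e p.2 g) =
          ((p.1 + Finsupp.single j 1 : Fin n →₀ ℕ) j : ℝ) •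
            (e (p.1 + Finsupp.single j 1) f * e p.2 g) +
          ((p.2 + Finsupp.single j 1 : Fin n →₀ ℕ) j : ℝ) •
            (e p.1 f * e (p.2 + Finsupp.single j 1) g) := by
        intro p _
        rw [Derivation.leibniz, he, he]
        simp only [smul_eq_mul, Finsupp.add_apply, Finsupp.single_eq_same, Nat.cast_add,
          Nat.cast_one]
        rw [mul_smul_comm, mul_smul_comm, add_comm, mul_comm (e p.2 g)]
      rw [Finset.sum_congr rfl h4, Finset.sum_add_distrib]
      rw [sum_antidiagonal_add_single I j (fun p => (p.1 j : ℝ) • (e p.1 f * e p.2 g))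
        (fun p hp => by simp [hp])]
      have h5 : ∑ p ∈ Finset.HasAntidiagonal.antidiagonal I,
          ((p.2 + Finsupp.single j 1 : Fin n →₀ ℕ) j : ℝ) •
            (e p.1 f * e (p.2 + Finsupp.single j 1) g) =
          ∑ p ∈ Finset.HasAntidiagonal.antidiagonal (I + Finsupp.single j 1),
            ((p : (Fin n →₀ ℕ) × (Fin n →₀ ℕ)).2 j : ℝ) • (e p.1 f * e p.2 g) := by
        rw [← sum_antidiagonal_swap, ← sum_antidiagonal_swap (I + Finsupp.single j 1)]
        exact sum_antidiagonal_add_single I j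
          (fun p => (p.1 j : ℝ) • (e p.2 f * e p.1 g)) (fun p hp => by simp [hp])
      rw [h5, ← Finset.sum_add_distrib, Finset.smul_sum]
      refine Finset.sum_congr rfl fun p hp => ?_
      rw [← add_smul]
      congr 1
      have h7 := DFunLike.congr_fun (Finset.HasAntidiagonal.mem_antidiagonal.1 hp) j
      simp only [Finsupp.add_apply, Finsupp.single_eq_same] at h7
      exact_mod_cast h7
    exact smul_right_injective R h1 (h2.trans (h3
      (fun J f => (multiFactorial J)⁻¹ • Q.DxI J f) fun J f => by
      rw [Derivation.map_smul, inv_multiFactorial_smul_Dx]))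

theorem DxI_mul (I : Fin n →₀ ℕ) (f g : R) :
    Q.DxI I (f * g) = ∑ p ∈ Finset.HasAntidiagonal.antidiagonal I,
      (∏ l, ((p.1 l + p.2 l).choose (p.1 l) : ℝ)) • (Q.DxI p.2 f * Q.DxI p.1 g) := by
  have h1 := congrArg (fun x => multiFactorial I • x) (Q.divided_leibniz I g f)
  simp only [smul_smul, mul_inv_cancel₀ (multiFactorial_ne_zero I), one_smul] at h1
  rw [mul_comm f g, h1, Finset.smul_sum]
  refine Finset.sum_congr rfl fun p hp => ?_
  rw [← Finset.HasAntidiagonal.mem_antidiagonal.1 hp, ← prod_choose_mul_multiFactorial,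
    smul_mul_smul_comm, smul_smul,
    mul_comm (Q.DxI p.1 g)]
  congr 1
  have h2 := multiFactorial_ne_zero p.1
  have h3 := multiFactorial_ne_zero p.2
  field_simp

theorem iterate_Dt_mul (F : Fin m → R) (s : ℕ) (f g : R) :
    (Q.Dt F)^[s] (f * g) = ∑ r ∈ Finset.range (s + 1),
      (s.choose r : ℝ) • ((Q.Dt F)^[s - r] f * (Q.Dt F)^[r] g) := by
  have key : (Q.Dt F)^[s] (g * f) = ∑ p ∈ Finset.HasAntidiagonal.antidiagonal s,
      (s.choose p.1 : ℝ) • ((Q.Dt F)^[p.1] g * (Q.Dt F)^[p.2] f) := by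
    simp_rw [Nat.cast_smul_eq_nsmul]
    induction s with
    | zero => simp
    | succ s ih =>
      rw [Finset.sum_antidiagonal_choose_succ_nsmul
        (fun a b => (Q.Dt F)^[a] g * (Q.Dt F)^[b] f) s, Function.iterate_succ_apply', ih, map_sum,
        ← Finset.sum_add_distrib]
      refine Finset.sum_congr rfl fun p hp => ?_
      rw [map_nsmul, Derivation.leibniz, Function.iterate_succ_apply', Function.iterate_succ_apply',
        smul_eq_mul, smul_eq_mul, mul_comm ((Q.Dt F)^[p.2] f)]
      have h1 : s.choose p.2 = s.choose p.1 :=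
        Nat.choose_symm_of_eq_add
          (by rw [add_comm]; exact (Finset.HasAntidiagonal.mem_antidiagonal.1 hp).symm)
      rw [h1, smul_add]
  rw [mul_comm f g, key, Finset.Nat.sum_antidiagonal_eq_sum_range_succ_mk]
  exact Finset.sum_congr rfl fun r _ => by rw [mul_comm]

/-- The coefficient of `D_x^J` in the adjoint of the linearization in the variables `u^i_{0,I}`. -/
def adjCoeff (F : Fin m → R) (i j : Fin m) (J : Fin n →₀ ℕ) : R :=
  ∑ᶠ K : Fin n →₀ ℕ, ((-1 : ℝ) ^ (J + K).degree * ∏ l, ((J l + K l).choose (J l) : ℝ)) •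
    Q.DxI K (Q.du i 0 (J + K) (F j))

/-- The coefficient of `D_x^J` in the operator `L_{ij}`. -/
def coeffX (F : Fin m → R) (i j : Fin m) (J : Fin n →₀ ℕ) : R :=
  Q.adjCoeff F i j J +
    if J = 0 then
      ∑ s : Fin h, if 0 < (s : ℕ) then
        (-1 : ℝ) ^ (s : ℕ) • (Q.Dt F)^[(s : ℕ)] (Q.du i s 0 (F j)) else 0
    else 0

/-- The coefficient of `D_t^r` in the operator `L_{ij}`. -/
def coeffT (F : Fin m → R) (i j : Fin m) (r : ℕ) : R :=
  ∑ s : Fin h, if r ≤ (s : ℕ) then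
    ((-1 : ℝ) ^ (s : ℕ) * ((s : ℕ).choose r : ℝ)) •
      (Q.Dt F)^[(s : ℕ) - r] (Q.du i s 0 (F j)) else 0

variable {F : Fin m → R} {N : ℕ}

theorem adjCoeff_eq_sum (hFN : ∀ j l I, N < I.degree → Q.du l 0 I (F j) = 0)
    (i j : Fin m) (J : Fin n →₀ ℕ) :
    Q.adjCoeff F i j J = ∑ K ∈ degreeLE n N,
      ((-1 : ℝ) ^ (J + K).degree * ∏ l, ((J l + K l).choose (J l) : ℝ)) •
        Q.DxI K (Q.du i 0 (J + K) (F j)) := by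
  refine finsum_eq_sum_of_support_subset _ fun K hK => ?_
  by_contra hKN
  rw [Finset.mem_coe, mem_degreeLE, not_le] at hKN
  refine hK ?_
  beta_reduce
  rw [hFN j i (J + K) (by rw [map_add]; omega), map_zero, smul_zero]

/-- In top degree every K ≠ 0 would require a derivative of F of order above N, so no derivative of
a coefficient enters. -/
theorem adjCoeff_of_degree_eq (hFN : ∀ j l I, N < I.degree → Q.du l 0 I (F j) = 0)
    (i j : Fin m) {J : Fin n →₀ ℕ} (hJ : J.degree = N) :
    Q.adjCoeff F i j J = (-1 : ℝ) ^ N • Q.du i 0 J (F j) := by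
  rw [adjCoeff, finsum_eq_single _ 0]
  · simp [hJ]
  · intro K hK
    have hK' : K.degree ≠ 0 := fun h0 => hK ((Finsupp.degree_eq_zero_iff K).1 h0)
    rw [hFN j i (J + K) (by rw [map_add]; omega), map_zero, smul_zero]

theorem euler_eq_sum_adjCoeff (hFN : ∀ j l I, N < I.degree → Q.du l 0 I (F j) = 0)
    (i j : Fin m) (g : R) :
    Q.euler i 0 (F j) g = ∑ J ∈ degreeLE n N, Q.adjCoeff F i j J * Q.DxI J g := by
  rw [Q.euler_eq_sum i 0 g (B := degreeLE n N) fun I hI => hFN j i I (by simpa using hI)]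
  simp_rw [Q.adjCoeff_eq_sum hFN, Finset.sum_mul]
  let φ : (Fin n →₀ ℕ) × (Fin n →₀ ℕ) → R := fun p =>
    ((-1 : ℝ) ^ (p.1 + p.2).degree * ∏ l, ((p.1 l + p.2 l).choose (p.1 l) : ℝ)) •
        Q.DxI p.2 (Q.du i 0 (p.1 + p.2) (F j)) * Q.DxI p.1 g
  refine Eq.trans ?_ (sum_degreeLE_sum_antidiagonal N φ fun p hp => ?_)
  · refine Finset.sum_congr rfl fun I _ => ?_
    rw [nDxI, LinearMap.smul_apply, DxI_mul, Finset.smul_sum]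
    refine Finset.sum_congr rfl fun p hp => ?_
    rw [← Finset.HasAntidiagonal.mem_antidiagonal.1 hp]
    simp only [φ, smul_smul, smul_mul_assoc]
  · simp only [φ]
    rw [hFN j i _ hp, map_zero, smul_zero, zero_mul]

/-- Above level 0 the right-hand sides contain only variables without x-derivatives, so a single
term of the Euler sum survives. -/
theorem euler_of_ne_zero (hF0 : ∀ j l s I, s ≠ 0 → I ≠ 0 → Q.du l s I (F j) = 0)
    (i j : Fin m) {s : ℕ} (hs : s ≠ 0) (g : R) :
    Q.euler i s (F j) g = Q.du i s 0 (F j) * g := by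
  rw [euler, finsum_eq_single _ 0]
  · simp
  · intro I hI
    rw [hF0 j i s I hs hI, zero_mul, map_zero]

theorem sum_iterate_Dt_mul (a : ℕ → R) (g : R) :
    (∑ s ∈ Finset.range h, if 0 < s then (-1 : ℝ) ^ s • (Q.Dt F)^[s] (a s * g) else 0) =
      (∑ s ∈ Finset.range h, if 0 < s then (-1 : ℝ) ^ s • (Q.Dt F)^[s] (a s) else 0) * g +
      ∑ r ∈ Finset.Ico 1 h, (∑ s ∈ Finset.range h, if r ≤ s then
        ((-1 : ℝ) ^ s * (s.choose r : ℝ)) • (Q.Dt F)^[s - r] (a s) else 0) * (Q.Dt F)^[r] g := by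
  simp_rw [Finset.sum_mul]
  rw [Finset.sum_comm, ← Finset.sum_add_distrib]
  refine Finset.sum_congr rfl fun s hs => ?_
  rw [Finset.mem_range] at hs
  simp_rw [ite_mul, zero_mul]
  split_ifs with h0
  · rw [← Finset.sum_filter, iterate_Dt_mul, Finset.smul_sum, Finset.range_eq_Ico,
      Finset.sum_eq_sum_Ico_succ_bot (Nat.succ_pos s)]
    congr 1
    · simp
    · refine Finset.sum_congr ?_ fun r _ => ?_
      · ext r
        simp only [Finset.mem_Ico, Finset.mem_filter]
        omega
      · rw [smul_smul, smul_mul_assoc]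
  · rw [zero_add, Finset.sum_eq_zero]
    intro r hr
    rw [Finset.mem_Ico] at hr
    rw [if_neg (by omega)]

/-- The Leibniz expansion of the adjoint linearized operator. -/
theorem adjoint_eq_sum_coeff (hh : 0 < h)
    (hFN : ∀ j l I, N < I.degree → Q.du l 0 I (F j) = 0)
    (hF0 : ∀ j l s I, s ≠ 0 → I ≠ 0 → Q.du l s I (F j) = 0) (i : Fin m) (χ : Fin m → R) :
    ∑ s ∈ Finset.range h, (-1 : ℝ) ^ s • (Q.Dt F)^[s] (∑ j, Q.euler i s (F j) (χ j)) =
      ∑ j, (∑ J ∈ degreeLE n N, Q.coeffX F i j J * Q.DxI J (χ j) +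
        ∑ r ∈ Finset.Ico 1 h, Q.coeffT F i j r * (Q.Dt F)^[r] (χ j)) := by
  have hsum : ∀ (s : ℕ) (g : Fin m → R),
      (Q.Dt F)^[s] (∑ j, g j) = ∑ j, (Q.Dt F)^[s] (g j) := by
    intro s g
    have h1 := map_sum ((Q.Dt F : R →ₗ[ℝ] R) ^ s) g Finset.univ
    simp only [Module.End.pow_apply] at h1
    exact h1
  simp_rw [hsum, Finset.smul_sum]
  rw [Finset.sum_comm]
  refine Finset.sum_congr rfl fun j _ => ?_
  have h1 : ∀ s ∈ Finset.range h, (-1 : ℝ) ^ s • (Q.Dt F)^[s] (Q.euler i s (F j) (χ j)) =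
      (if s = 0 then Q.euler i 0 (F j) (χ j) else 0) +
      if 0 < s then (-1 : ℝ) ^ s • (Q.Dt F)^[s] (Q.du i s 0 (F j) * χ j) else 0 := by
    intro s _
    rcases Nat.eq_zero_or_pos s with rfl | hs
    · simp
    · rw [if_neg hs.ne', if_pos hs, zero_add, Q.euler_of_ne_zero hF0 i j hs.ne']
  rw [Finset.sum_congr rfl h1, Finset.sum_add_distrib, Finset.sum_ite_eq',
    if_pos (Finset.mem_range.2 hh), Q.sum_iterate_Dt_mul (F := F) (fun s => Q.du i s 0 (F j)),
    Q.euler_eq_sum_adjCoeff hFN, ← add_assoc]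
  congr 1
  · simp_rw [coeffX, add_mul, Finset.sum_add_distrib, ite_mul, zero_mul]
    rw [Finset.sum_ite_eq', if_pos (by simp), DxI_zero,
      ← Fin.sum_univ_eq_sum_range (fun s =>
        if 0 < s then (-1 : ℝ) ^ s • (Q.Dt F)^[s] (Q.du i s 0 (F j)) else 0)]
  · refine Finset.sum_congr rfl fun r _ => ?_
    rw [coeffT, ← Fin.sum_univ_eq_sum_range (fun s => if r ≤ s then
        ((-1 : ℝ) ^ s * (s.choose r : ℝ)) • (Q.Dt F)^[s - r] (Q.du i s 0 (F j)) else 0)]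

/-! ### Leading terms of iterated total derivatives. -/

theorem degree_sub_single {M : Fin n →₀ ℕ} {j : Fin n} (hj : M j ≠ 0) :
    (M - Finsupp.single j 1).degree + 1 = M.degree := by
  have h1 : M - Finsupp.single j 1 + Finsupp.single j 1 = M := tsub_add_cancel_of_le
    (Finsupp.single_le_iff.2 (Nat.one_le_iff_ne_zero.2 hj))
  conv_rhs => rw [← h1, map_add, Finsupp.degree_single]

theorem du_DxI_eq_zero {i : Fin m} {s a : ℕ} {f : R} (hf : ∀ I, a < I.degree → Q.du i s I f = 0)
    (J M : Fin n →₀ ℕ) (hM : J.degree + a < M.degree) : Q.du i s M (Q.DxI J f) = 0 := by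
  induction J using multiindex_induction generalizing M with
  | h0 => rw [DxI_zero]; exact hf M (by simpa using hM)
  | hs J j ih =>
    rw [map_add, Finsupp.degree_single] at hM
    rw [DxI_add_single, du_Dx, ih M (by omega), map_zero, zero_add]
    split_ifs with hj
    · exact ih _ (by have := degree_sub_single hj; omega)
    · rfl

/-- In top order only the commutator terms survive, so D_x^J acts on the leading part as
multiplication by q^J. -/
theorem du_DxI_of_degree_eq {i : Fin m} {s a : ℕ} {f : R}
    (hf : ∀ I, a < I.degree → Q.du i s I f = 0)
    (J M : Fin n →₀ ℕ) (hM : M.degree = J.degree + a) :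
    Q.du i s M (Q.DxI J f) = if J ≤ M then Q.du i s (M - J) f else 0 := by
  induction J using multiindex_induction generalizing M with
  | h0 => simp
  | hs J j ih =>
    rw [map_add, Finsupp.degree_single] at hM
    rw [DxI_add_single, du_Dx, Q.du_DxI_eq_zero hf J M (by omega), map_zero, zero_add]
    by_cases hj : M j = 0
    · have h1 : ¬ (J + Finsupp.single j 1 ≤ M) := fun hle => by
        have := hle j
        simp [hj] at this
      simp [hj, h1]
    · have hle : Finsupp.single j 1 ≤ M :=
        Finsupp.single_le_iff.2 (Nat.one_le_iff_ne_zero.2 hj)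
      rw [if_pos hj, ih _ (by have := degree_sub_single hj; omega), tsub_tsub,
        add_comm (Finsupp.single j 1) J]
      exact if_congr (le_tsub_iff_right hle) rfl rfl

/-- The pairs `(|I|, s)` such that `D_t^e f` may depend on `u_{s,I}` if the leading variables of `f`
are the `u_{r,I}` with `|I| = k`. -/
def Allowed (k r N h e i s : ℕ) : Prop :=
  i < k ∨ (i = k ∧ s ≤ r + e) ∨ (k < i ∧ i < k + N ∧ s < e) ∨ (i = k + N ∧ s + h ≤ r + e)

theorem du_DxI_F_eq_zero (hFN : ∀ j l I, N < I.degree → Q.du l 0 I (F j) = 0)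
    (hF0 : ∀ j l s I, s ≠ 0 → I ≠ 0 → Q.du l s I (F j) = 0) (j l : Fin m) (s : ℕ)
    (J M : Fin n →₀ ℕ) (hM : J.degree + (if s = 0 then N else 0) < M.degree) :
    Q.du l s M (Q.DxI J (F j)) = 0 := by
  split_ifs at hM with hs
  · subst hs
    exact Q.du_DxI_eq_zero (hFN j l) J M hM
  · refine Q.du_DxI_eq_zero (a := 0) (fun I hI => hF0 j l s I hs ?_) J M hM
    rintro rfl
    simp at hI

/-- D_t raises the level s by one and replaces u_{h-1,I} by D_x^I F, which contains variables of
order up to |I| + N at level 0 but only up to |I| at positive levels. Hence an increase of order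
enters at level 0 and then climbs one level per step: orders strictly between k and k + N occur only
at levels below e. Order k + N arises only from variables of order k at level h - 1. The bound e < h
prevents variables of order above k from having reached level h - 1, so nothing passes through F a
second time beyond order k + N. -/
theorem du_Dt_eq_zero_of_allowed (hN : 0 < N)
    (hFN : ∀ j l I, N < I.degree → Q.du l 0 I (F j) = 0)
    (hF0 : ∀ j l s I, s ≠ 0 → I ≠ 0 → Q.du l s I (F j) = 0) {k r e : ℕ} (hr : r < h) (he : e < h)
    {f : R} (hf : ∀ l s I, s < h → ¬ Allowed k r N h e I.degree s → Q.du l s I f = 0)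
    (l : Fin m) (s : ℕ) (I : Fin n →₀ ℕ) (hs : s < h)
    (hI : ¬ Allowed k r N h (e + 1) I.degree s) : Q.du l s I (Q.Dt F f) = 0 := by
  unfold Allowed at hI hf
  rw [Q.du_Dt F l hs, hf l s I hs (by omega), map_zero, zero_add]
  have h1 : Q.duPred l s I f = 0 := by
    unfold duPred
    split_ifs with h0
    · rfl
    · exact hf l (s - 1) I (by omega) (by omega)
  rw [h1, zero_add]
  refine finsum_eq_zero_of_forall_eq_zero fun p => ?_
  by_cases hp : p.2.degree + (if s = 0 then N else 0) < I.degree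
  · rw [Q.du_DxI_F_eq_zero hFN hF0 _ _ _ _ _ hp, zero_mul]
  · rw [hf p.1 (h - 1) p.2 (by omega) (by split_ifs at hp <;> omega), mul_zero]

theorem du_iterate_Dt_eq_zero (hN : 0 < N)
    (hFN : ∀ j l I, N < I.degree → Q.du l 0 I (F j) = 0)
    (hF0 : ∀ j l s I, s ≠ 0 → I ≠ 0 → Q.du l s I (F j) = 0) {k r : ℕ} (hr : r < h) {f : R}
    (hk : ∀ l s I, k < I.degree → Q.du l s I f = 0)
    (hkr : ∀ l s I, I.degree = k → r < s → Q.du l s I f = 0) {e : ℕ} (he : e ≤ h)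
    (l : Fin m) (s : ℕ) (I : Fin n →₀ ℕ) (hs : s < h)
    (hI : ¬ Allowed k r N h e I.degree s) : Q.du l s I ((Q.Dt F)^[e] f) = 0 := by
  induction e generalizing l s I with
  | zero =>
    unfold Allowed at hI
    rcases lt_trichotomy I.degree k with h1 | h1 | h1
    · omega
    · exact hkr l s I h1 (by omega)
    · exact hk l s I h1
  | succ e ih =>
    rw [Function.iterate_succ_apply']
    exact Q.du_Dt_eq_zero_of_allowed hN hFN hF0 hr (by omega) (ih (by omega)) l s I hs hI

/-- As long as level h - 1 is not passed, D_t merely shifts the level of the leading variables. -/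
theorem du_iterate_Dt_of_lt (hN : 0 < N)
    (hFN : ∀ j l I, N < I.degree → Q.du l 0 I (F j) = 0)
    (hF0 : ∀ j l s I, s ≠ 0 → I ≠ 0 → Q.du l s I (F j) = 0) {k r : ℕ} {f : R}
    (hk : ∀ l s I, k < I.degree → Q.du l s I f = 0)
    (hkr : ∀ l s I, I.degree = k → r < s → Q.du l s I f = 0) {e : ℕ} (he : r + e < h)
    (l : Fin m) {I : Fin n →₀ ℕ} (hI : I.degree = k) :
    Q.du l (r + e) I ((Q.Dt F)^[e] f) = Q.du l r I f := by
  induction e with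
  | zero => rfl
  | succ e ih =>
    have hz := fun l s I => Q.du_iterate_Dt_eq_zero hN hFN hF0 (by omega : r < h) hk hkr
      (by omega : e ≤ h) l s I
    unfold Allowed at hz
    rw [Function.iterate_succ_apply', Q.du_Dt F l he, hz l _ I he (by omega), map_zero, zero_add,
      duPred, if_neg (by omega), show r + (e + 1) - 1 = r + e by omega, ih (by omega)]
    rw [finsum_eq_zero_of_forall_eq_zero, add_zero]
    intro p
    by_cases hp : p.2.degree < I.degree
    · rw [Q.du_DxI_F_eq_zero hFN hF0 _ _ _ _ _ (by rw [if_neg (by omega)]; omega), zero_mul]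
    · rw [hz p.1 (h - 1) p.2 (by omega) (by omega), mul_zero]

/-- The leading part of `D_t^e f` for the first `e` for which it involves the right-hand sides. -/
theorem du_iterate_Dt_wrap (hN : 0 < N)
    (hFN : ∀ j l I, N < I.degree → Q.du l 0 I (F j) = 0)
    (hF0 : ∀ j l s I, s ≠ 0 → I ≠ 0 → Q.du l s I (F j) = 0) {k r : ℕ} {f : R}
    (hk : ∀ l s I, k < I.degree → Q.du l s I f = 0)
    (hkr : ∀ l s I, I.degree = k → r < s → Q.du l s I f = 0) {e : ℕ} (he : r + e + 1 = h)
    (l : Fin m) {M : Fin n →₀ ℕ} (hM : M.degree = k + N) :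
    Q.du l 0 M ((Q.Dt F)^[e + 1] f) =
      ∑ j, ∑ p ∈ Finset.HasAntidiagonal.antidiagonal M,
        if p.1.degree = k then Q.du j r p.1 f * Q.du l 0 p.2 (F j) else 0 := by
  have hz := fun l s I => Q.du_iterate_Dt_eq_zero hN hFN hF0 (by omega : r < h) hk hkr
    (by omega : e ≤ h) l s I
  unfold Allowed at hz
  rw [Function.iterate_succ_apply', Q.du_Dt F l (by omega), hz l _ M (by omega) (by omega),
    map_zero, zero_add, duPred, if_pos rfl, zero_add]
  have h1 : ∀ p : Fin m × (Fin n →₀ ℕ),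
      Q.du l 0 M (Q.DxI p.2 (F p.1)) * Q.du p.1 (h - 1) p.2 ((Q.Dt F)^[e] f) =
      if p.2 ≤ M ∧ p.2.degree = k then Q.du p.1 r p.2 f * Q.du l 0 (M - p.2) (F p.1) else 0 := by
    rintro ⟨j, I⟩
    simp only
    -- Below order k, D_x^I F does not reach order k + N. At order k both factors are leading
    -- coefficients. Above order k, D_t^e f does not yet involve level h - 1.
    rcases lt_trichotomy I.degree k with h1 | h1 | h1
    · rw [Q.du_DxI_F_eq_zero hFN hF0 _ _ _ _ _ (by rw [if_pos rfl]; omega), zero_mul,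
        if_neg (by omega)]
    · rw [Q.du_DxI_of_degree_eq (hFN j l) I M (by omega), show h - 1 = r + e by omega,
        Q.du_iterate_Dt_of_lt hN hFN hF0 hk hkr (by omega) j h1]
      simp only [h1, and_true]
      split_ifs
      · rw [mul_comm]
      · rw [zero_mul]
    · rw [hz j (h - 1) I (by omega) (by omega), mul_zero, if_neg (by omega)]
  simp_rw [h1]
  rw [finsum_eq_sum_of_support_subset (s := Finset.univ ×ˢ degreeLE n k), Finset.sum_product]
  · refine Finset.sum_congr rfl fun j _ => ?_
    exact sum_ite_le_eq_sum_antidiagonal M k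
      (fun I J => Q.du j r I f * Q.du l 0 J (F j)) fun J _ hJ => by simp [hJ]
  · intro p hp
    by_contra hpB
    refine hp (if_neg fun hp' => hpB ?_)
    simp [hp'.2]

theorem du_iterate_Dt_h (hN : 0 < N)
    (hFN : ∀ j l I, N < I.degree → Q.du l 0 I (F j) = 0)
    (hF0 : ∀ j l s I, s ≠ 0 → I ≠ 0 → Q.du l s I (F j) = 0) {k r : ℕ} (hr : r < h) {f : R}
    (hk : ∀ l s I, k < I.degree → Q.du l s I f = 0)
    (hkr : ∀ l s I, I.degree = k → r < s → Q.du l s I f = 0)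
    (l : Fin m) {M : Fin n →₀ ℕ} (hM : M.degree = k + N) :
    Q.du l r M ((Q.Dt F)^[h] f) =
      ∑ j, ∑ p ∈ Finset.HasAntidiagonal.antidiagonal M,
        if p.1.degree = k then Q.du j r p.1 f * Q.du l 0 p.2 (F j) else 0 := by
  -- The passage through F takes h - r steps and ends at level 0. The remaining r steps shift the
  -- level back up to r without changing the leading coefficient.
  have key : ∀ s, s ≤ r → Q.du l s M ((Q.Dt F)^[h - r + s] f) =
      ∑ j, ∑ p ∈ Finset.HasAntidiagonal.antidiagonal M,
        if p.1.degree = k then Q.du j r p.1 f * Q.du l 0 p.2 (F j) else 0 := by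
    intro s hs
    induction s with
    | zero =>
      have h1 : h - r + 0 = (h - r - 1) + 1 := by omega
      rw [h1]
      exact Q.du_iterate_Dt_wrap hN hFN hF0 hk hkr (by omega) l hM
    | succ s ih =>
      have hz := fun l s' I => Q.du_iterate_Dt_eq_zero hN hFN hF0 hr hk hkr
        (by omega : h - r + s ≤ h) l s' I
      unfold Allowed at hz
      rw [← add_assoc, Function.iterate_succ_apply', Q.du_Dt F l (by omega),
        hz l _ M (by omega) (by omega), map_zero, zero_add, duPred, if_neg (by omega),
        Nat.add_sub_cancel, ih (by omega), finsum_eq_zero_of_forall_eq_zero, add_zero]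
      intro p
      by_cases hp : p.2.degree < M.degree
      · rw [Q.du_DxI_F_eq_zero hFN hF0 _ _ _ _ _ (by rw [if_neg (by omega)]; omega), zero_mul]
      · rw [hz p.1 (h - 1) p.2 (by omega) (by omega), mul_zero]
  have h2 := key r le_rfl
  rwa [show h - r + r = h by omega] at h2

/-- The leading part of the adjoint linearized equation. -/
theorem leading_identity (hN : 0 < N)
    (hFN : ∀ j l I, N < I.degree → Q.du l 0 I (F j) = 0)
    (hF0 : ∀ j l s I, s ≠ 0 → I ≠ 0 → Q.du l s I (F j) = 0) {k r : ℕ} (hr : r < h)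
    {χ : Fin m → R} (hk : ∀ i l s I, k < I.degree → Q.du l s I (χ i) = 0)
    (hkr : ∀ i l s I, I.degree = k → r < s → Q.du l s I (χ i) = 0)
    (hX : ∀ i j J l s I, J.degree ≤ N → k + N ≤ I.degree → Q.du l s I (Q.coeffX F i j J) = 0)
    (hT : ∀ i j r' l s I, 0 < r' → r' < h → k + N ≤ I.degree →
      Q.du l s I (Q.coeffT F i j r') = 0) (i : Fin m)
    (heq : (-1 : ℝ) ^ h • (Q.Dt F)^[h] (χ i) =
      ∑ j, (∑ J ∈ degreeLE n N, Q.coeffX F i j J * Q.DxI J (χ j) +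
        ∑ r ∈ Finset.Ico 1 h, Q.coeffT F i j r * (Q.Dt F)^[r] (χ j)))
    (l : Fin m) {M : Fin n →₀ ℕ} (hM : M.degree = k + N) :
    (-1 : ℝ) ^ h • ∑ j, ∑ p ∈ Finset.HasAntidiagonal.antidiagonal M,
        (if p.1.degree = k then Q.du j r p.1 (χ i) * Q.du l 0 p.2 (F j) else 0) =
      (-1 : ℝ) ^ N • ∑ j, ∑ p ∈ Finset.HasAntidiagonal.antidiagonal M,
        (if p.1.degree = N then Q.du i 0 p.1 (F j) * Q.du l r p.2 (χ j) else 0) := by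
  have h1 := congrArg (Q.du l r M) heq
  rw [Derivation.map_smul, Q.du_iterate_Dt_h hN hFN hF0 hr (hk i) (hkr i) l hM, map_sum] at h1
  rw [h1, Finset.smul_sum]
  refine Finset.sum_congr rfl fun j _ => ?_
  rw [map_add, map_sum, map_sum]
  -- The coefficient does not involve order k + N, and D_t^{r'} χ with r' < h involves it only at
  -- levels s with s + h ≤ r + r', hence s < r.
  have h2 : ∑ r' ∈ Finset.Ico 1 h, Q.du l r M (Q.coeffT F i j r' * (Q.Dt F)^[r'] (χ j)) = 0 := by
    refine Finset.sum_eq_zero fun r' hr' => ?_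
    rw [Finset.mem_Ico] at hr'
    rw [Derivation.leibniz, hT i j r' l r M (by omega) hr'.2 hM.ge, smul_zero, add_zero,
      Q.du_iterate_Dt_eq_zero hN hFN hF0 hr (hk j) (hkr j) (by omega : r' ≤ h) l r M hr
        (by unfold Allowed; omega), smul_zero]
  rw [h2, add_zero, ← sum_ite_le_eq_sum_antidiagonal M N
    (fun J I => Q.du i 0 J (F j) * Q.du l r I (χ j)) (B := degreeLE n N)
    (fun J _ hJ => by simp [hJ]), Finset.smul_sum]
  refine Finset.sum_congr rfl fun J hJ => ?_
  rw [mem_degreeLE] at hJ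
  rw [Derivation.leibniz, hX i j J l r M hJ hM.ge, smul_zero, add_zero]
  rcases hJ.lt_or_eq with hlt | hJN
  · rw [Q.du_DxI_eq_zero (hk j l r) J M (by omega), smul_zero, if_neg (by omega), smul_zero]
  · rw [Q.du_DxI_of_degree_eq (hk j l r) J M (by omega), coeffX, if_neg, add_zero,
      Q.adjCoeff_of_degree_eq hFN i j hJN]
    · simp only [hJN, and_true, smul_eq_mul]
      split_ifs
      · rw [smul_mul_assoc]
      · simp
    -- The zeroth-order contributions of the D_t^s sit at J = 0, which is not of degree N since N >
    -- 0.
    · rintro rfl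
      simp at hJN
      omega

end JetAlgebra

/-! ### Smooth functions on U as a jet algebra, with `Rep` transferring identities to jet functions.
-/

theorem infty_add_one_le : (∞ : WithTop ℕ∞) + 1 ≤ ∞ := le_rfl

/-- The algebra of smooth functions on `U`, each depending on finitely many coordinates. -/
def smoothAlgebra (U : Set (Jet n m h)) : Subalgebra ℝ (U → ℝ) where
  carrier := {a | ∃ f, IsSmooth U f ∧ ∀ θ : U, a θ = f θ}
  mul_mem' := by
    rintro a b ⟨f, hf, haf⟩ ⟨g, hg, hbg⟩
    exact ⟨_, IsFunOf.mul hf hg, fun θ => by simp [haf, hbg]⟩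
  add_mem' := by
    rintro a b ⟨f, hf, haf⟩ ⟨g, hg, hbg⟩
    exact ⟨_, IsFunOf.add hf hg, fun θ => by simp [haf, hbg]⟩
  algebraMap_mem' r := ⟨_, IsFunOf.const U _ _ r, fun _ => rfl⟩

variable {U : Set (Jet n m h)}

/-- `f` takes on `U` the values of the element `a` of the algebra of smooth functions. -/
def Rep (f : JetFun n m h) (a : smoothAlgebra U) : Prop := ∀ θ : U, a.1 θ = f θ

theorem IsSmooth.exists_rep {f : JetFun n m h} (hf : IsSmooth U f) :
    ∃ a : smoothAlgebra U, Rep f a :=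
  ⟨⟨fun θ => f θ, f, hf, fun _ => rfl⟩, fun _ => rfl⟩

theorem Rep.isSmooth {f : JetFun n m h} {a : smoothAlgebra U} (hf : Rep f a) : IsSmooth U f := by
  obtain ⟨g, hg, hag⟩ := a.2
  exact hg.congr fun θ hθ => ((hf ⟨θ, hθ⟩).symm.trans (hag ⟨θ, hθ⟩))

/-- An extension of an element of the algebra of smooth functions to all jets. -/
def ext (a : smoothAlgebra U) : JetFun n m h := Function.extend Subtype.val a.1 0

theorem rep_ext (a : smoothAlgebra U) : Rep (ext a) a := fun θ =>
  (Subtype.val_injective.extend_apply a.1 0 θ).symm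

theorem Rep.congr {f g : JetFun n m h} {a : smoothAlgebra U} (hf : Rep f a)
    (hfg : ∀ θ ∈ U, g θ = f θ) : Rep g a := fun θ => (hf θ).trans (hfg θ θ.2).symm

theorem Rep.eq_of {f g : JetFun n m h} {a : smoothAlgebra U} (hf : Rep f a) (hg : Rep g a) :
    ∀ θ ∈ U, f θ = g θ := fun θ hθ => (hf ⟨θ, hθ⟩).symm.trans (hg ⟨θ, hθ⟩)

theorem Rep.add {f g : JetFun n m h} {a b : smoothAlgebra U} (hf : Rep f a) (hg : Rep g b) :
    Rep (fun θ => f θ + g θ) (a + b) := fun θ => congrArg₂ (· + ·) (hf θ) (hg θ)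

theorem Rep.mul {f g : JetFun n m h} {a b : smoothAlgebra U} (hf : Rep f a) (hg : Rep g b) :
    Rep (fun θ => f θ * g θ) (a * b) := fun θ => congrArg₂ (· * ·) (hf θ) (hg θ)

theorem Rep.const_mul {f : JetFun n m h} {a : smoothAlgebra U} (hf : Rep f a) (r : ℝ) :
    Rep (fun θ => r * f θ) (r • a) := fun θ => congrArg (r * ·) (hf θ)

theorem rep_zero : Rep (fun _ => 0) (0 : smoothAlgebra U) := fun _ => rfl

theorem Rep.sum {ι : Type*} (s : Finset ι) {f : ι → JetFun n m h} {a : ι → smoothAlgebra U}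
    (hf : ∀ i ∈ s, Rep (f i) (a i)) : Rep (fun θ => ∑ i ∈ s, f i θ) (∑ i ∈ s, a i) := by
  intro θ
  rw [AddSubmonoidClass.coe_finsetSum, Finset.sum_apply]
  exact Finset.sum_congr rfl fun i hi => hf i hi θ

theorem Rep.finsum {ι : Type*} {f : ι → JetFun n m h} {a : ι → smoothAlgebra U}
    (hf : ∀ i, Rep (f i) (a i)) (hfin : (Function.support a).Finite) :
    Rep (fun θ => ∑ᶠ i, f i θ) (∑ᶠ i, a i) := by
  intro θ
  beta_reduce
  rw [finsum_eq_sum_of_support_subset (s := hfin.toFinset) a (by simp),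
    finsum_eq_sum_of_support_subset (s := hfin.toFinset)]
  · exact Rep.sum _ (fun i _ => hf i) θ
  · intro i hi
    rw [Set.Finite.coe_toFinset]
    intro h0
    refine hi ?_
    beta_reduce
    rw [← hf i θ, h0]
    rfl

theorem Rep.ite {p : Prop} [Decidable p] {f g : JetFun n m h} {a b : smoothAlgebra U}
    (hf : Rep f a) (hg : Rep g b) : Rep (fun θ => if p then f θ else g θ) (if p then a else b) := by
  split_ifs
  · exact hf
  · exact hg

/-- The partial derivative with respect to `c` on the algebra of smooth functions. -/
def smoothPd (hU : IsOpen U) (c : Coord n m h) : Derivation ℝ (smoothAlgebra U) (smoothAlgebra U) :=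
  Derivation.mk'
    { toFun := fun a => ⟨fun θ => pd c (ext a) θ, pd c (ext a),
        (rep_ext a).isSmooth.pd hU infty_add_one_le c, fun _ => rfl⟩
      map_add' := fun a b => by
        refine Subtype.ext (funext fun θ => ?_)
        have h1 := (rep_ext a).isSmooth.hasDerivAt hU (by simp) c θ.2
        have h2 := (rep_ext b).isSmooth.hasDerivAt hU (by simp) c θ.2
        exact (pd_congr hU ((rep_ext (a + b)).eq_of ((rep_ext a).add (rep_ext b))) c θ.2).trans
          (h1.add h2).deriv
      map_smul' := fun r a => by
        refine Subtype.ext (funext fun θ => ?_)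
        have h1 := (rep_ext a).isSmooth.hasDerivAt hU (by simp) c θ.2
        exact (pd_congr hU ((rep_ext (r • a)).eq_of ((rep_ext a).const_mul r)) c θ.2).trans
          (h1.const_mul r).deriv }
    fun a b => by
      refine Subtype.ext (funext fun θ => ?_)
      have h1 := (rep_ext a).isSmooth.hasDerivAt hU (by simp) c θ.2
      have h2 := (rep_ext b).isSmooth.hasDerivAt hU (by simp) c θ.2
      refine ((pd_congr hU ((rep_ext (a * b)).eq_of ((rep_ext a).mul (rep_ext b))) c θ.2).trans
          (h1.mul h2).deriv).trans ?_
      simp only [Function.update_eq_self]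
      rw [← rep_ext a θ, ← rep_ext b θ, add_comm, mul_comm (pd c (ext a) θ)]
      rfl

theorem Rep.pd (hU : IsOpen U) {f : JetFun n m h} {a : smoothAlgebra U} (hf : Rep f a)
    (c : Coord n m h) : Rep (pd c f) (smoothPd hU c a) := fun _ =>
  pd_congr hU ((rep_ext a).eq_of hf) c (Subtype.coe_prop _)

/-- The jet algebra of smooth functions on `U`. -/
def smoothJet (hU : IsOpen U) : JetAlgebra n m h (smoothAlgebra U) where
  d := smoothPd hU
  d_comm a b f := Subtype.ext (funext fun θ => by
    rw [((rep_ext f).pd hU b).pd hU a θ, ((rep_ext f).pd hU a).pd hU b θ]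
    exact (rep_ext f).isSmooth.pd_comm hU a b θ.2)
  finite_d f := by
    obtain ⟨s, -, hs⟩ := (rep_ext f).isSmooth.finite_pd hU (by simp)
    refine s.finite_toSet.subset fun c hc => ?_
    by_contra hcs
    refine hc (Subtype.ext (funext fun θ => ?_))
    rw [(rep_ext f).pd hU c θ]
    exact hs c hcs θ θ.2
  X c := ⟨fun θ => θ.1 c, fun θ => θ c, IsFunOf.coord U _ c, fun _ => rfl⟩
  d_X c c' := Subtype.ext (funext fun θ => by
    have h1 : Rep (U := U) (fun θ => θ c')
      ⟨fun θ => θ.1 c', fun θ => θ c', IsFunOf.coord U _ c', fun _ => rfl⟩ := fun _ => rfl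
    rw [h1.pd hU c θ]
    unfold GenEvol.pd
    split_ifs with hc
    · subst hc
      simp
    · have : ∀ r, Function.update θ.1 c r c' = θ.1 c' := fun r =>
        Function.update_of_ne (Ne.symm hc) _ _
      simp [this])

theorem Rep.d (hU : IsOpen U) {f : JetFun n m h} {a : smoothAlgebra U} (hf : Rep f a)
    (c : Coord n m h) : Rep (GenEvol.pd c f) ((smoothJet hU).d c a) := hf.pd hU c

theorem Rep.du (hU : IsOpen U) {f : JetFun n m h} {a : smoothAlgebra U} (hf : Rep f a)
    (i : Fin m) (s : Fin h) (I : Fin n →₀ ℕ) :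
    Rep (GenEvol.pd (.u i s I) f) ((smoothJet hU).du i s I a) := by
  rw [JetAlgebra.du_of_lt _ _ s.2]
  exact hf.pd hU _

theorem rep_X (hU : IsOpen U) (c : Coord n m h) : Rep (fun θ => θ c) ((smoothJet hU).X c) :=
  fun _ => rfl

theorem injective_uncurry_u : Function.Injective
    fun p : Fin m × Fin h × (Fin n →₀ ℕ) => Coord.u p.1 p.2.1 p.2.2 := by
  rintro ⟨i, s, I⟩ ⟨i', s', I'⟩ hp
  simpa using hp

theorem notMem_range_u {P : Coord n m h → Prop} (ht : P .t) (hx : ∀ j, P (.x j))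
    (c : Coord n m h)
    (hc : c ∉ Set.range fun p : Fin m × Fin h × (Fin n →₀ ℕ) => Coord.u p.1 p.2.1 p.2.2) :
    P c := by
  match c with
  | .t => exact ht
  | .x j => exact hx j
  | .u i s I => exact absurd ⟨(i, s, I), rfl⟩ hc

/-- Splitting off one base coordinate from a vector field. -/
theorem vf_eq_add_finsum {R : Type*} [CommRing R] [Algebra ℝ R] (Q : JetAlgebra n m h R)
    {a b : Coord n m h → R} (c : Coord n m h) (f : R)
    (hab : ∀ c', a c' = (if c' = c then 1 else 0) + b c')
    (hbt : b .t = 0) (hbx : ∀ j, b (.x j) = 0) :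
    Q.vf a f = Q.d c f + ∑ᶠ p : Fin m × Fin h × (Fin n →₀ ℕ),
      b (.u p.1 p.2.1 p.2.2) * Q.d (.u p.1 p.2.1 p.2.2) f := by
  rw [funext hab, Q.vf_add, Q.vf_ite_eq,
    Q.vf_eq_finsum_comp injective_uncurry_u (notMem_range_u hbt hbx)]

theorem finite_support_mul_d {R : Type*} [CommRing R] [Algebra ℝ R] (Q : JetAlgebra n m h R)
    (b : Fin m × Fin h × (Fin n →₀ ℕ) → R) (f : R) :
    (Function.support fun p : Fin m × Fin h × (Fin n →₀ ℕ) =>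
      b p * Q.d (.u p.1 p.2.1 p.2.2) f).Finite :=
  ((Q.finite_d f).preimage injective_uncurry_u.injOn).subset fun p hp h0 => hp (by
    beta_reduce
    rw [h0, mul_zero])

theorem Rep.Dx (hU : IsOpen U) {f : JetFun n m h} {a : smoothAlgebra U} (hf : Rep f a)
    (j : Fin n) : Rep (GenEvol.Dx j f) ((smoothJet hU).Dx j a) := by
  rw [JetAlgebra.Dx, vf_eq_add_finsum (smoothJet hU) (.x j) a (b := fun c => match c with
    | .u k s I => (smoothJet hU).X (.u k s (I + Finsupp.single j 1))
    | _ => 0)]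
  · exact (hf.d hU _).add (Rep.finsum (fun p => (rep_X hU _).mul (hf.d hU _))
      (finite_support_mul_d _ _ _))
  · intro c
    match c with
    | .t => simp [JetAlgebra.xCoeff]
    | .x i => simp [JetAlgebra.xCoeff]
    | .u k s I => simp [JetAlgebra.xCoeff]
  · rfl
  · intro j; rfl

theorem Rep.iterate {D : JetFun n m h → JetFun n m h} {D' : smoothAlgebra U → smoothAlgebra U}
    (hD : ∀ {f a}, Rep f a → Rep (D f) (D' a)) {f : JetFun n m h} {a : smoothAlgebra U}
    (hf : Rep f a) (k : ℕ) : Rep (D^[k] f) (D'^[k] a) := by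
  induction k with
  | zero => exact hf
  | succ k ih =>
    rw [Function.iterate_succ_apply', Function.iterate_succ_apply']
    exact hD ih

theorem Rep.DxI (hU : IsOpen U) {f : JetFun n m h} {a : smoothAlgebra U} (hf : Rep f a)
    (I : Fin n →₀ ℕ) : Rep (GenEvol.DxI I f) ((smoothJet hU).DxI I a) := by
  rw [JetAlgebra.DxI_apply, GenEvol.DxI]
  induction List.finRange n with
  | nil => exact hf
  | cons j l ih => exact ih.iterate (fun h => h.Dx hU j) (I j)

/-! ### The system and its conserved currents in the jet algebra. -/

namespace GenEvolSystem

variable (E : GenEvolSystem n m h)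

/-- The jet algebra of smooth functions on the domain of the system. -/
abbrev jet : JetAlgebra n m h (smoothAlgebra E.U) := smoothJet E.isOpen_U

theorem exists_rep_F : ∃ F : Fin m → smoothAlgebra E.U, ∀ i, Rep (E.F i) (F i) := by
  choose F hF using fun i => IsSmooth.exists_rep ((E.smooth_F i).mono (Set.subset_univ _))
  exact ⟨F, hF⟩

variable {E} {F : Fin m → smoothAlgebra E.U}

theorem rep_Dt (hF : ∀ i, Rep (E.F i) (F i)) {f : JetFun n m h} {a : smoothAlgebra E.U}
    (hf : Rep f a) : Rep (E.Dt f) (E.jet.Dt F a) := by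
  rw [JetAlgebra.Dt, vf_eq_add_finsum E.jet .t a (b := fun c => match c with
    | .u k s I => E.jet.tCoeff F (.u k s I)
    | _ => 0)]
  · refine (hf.d E.isOpen_U _).add (Rep.finsum (fun p => Rep.mul ?_ (hf.d E.isOpen_U _))
      (finite_support_mul_d _ _ _))
    intro θ
    simp only [JetAlgebra.tCoeff, dtCoord]
    split_ifs
    · rfl
    · exact (hF p.1).DxI E.isOpen_U p.2.2 θ
  · intro c
    match c with
    | .t => simp [JetAlgebra.tCoeff]
    | .x i => simp [JetAlgebra.tCoeff]
    | .u k s I => simp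
  · rfl
  · intro j; rfl

theorem du_F_eq_zero (hF : ∀ i, Rep (E.F i) (F i)) (j l : Fin m) (s : ℕ) (I : Fin n →₀ ℕ)
    (hs : s ≠ 0) (hI : I ≠ 0) : E.jet.du l s I (F j) = 0 := by
  by_cases hsh : s < h
  · obtain ⟨V, hV, hpd⟩ := (E.smooth_F j).finite_pd E.isOpen_U (by simp)
    refine Subtype.ext (funext fun θ => ?_)
    rw [(hF j).du E.isOpen_U l ⟨s, hsh⟩ I θ]
    refine hpd _ (fun hm => ?_) θ θ.2
    rcases hV hm l ⟨s, hsh⟩ I rfl with h0 | h0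
    · exact hs h0
    · exact hI h0
  · exact E.jet.du_of_le l (not_lt.1 hsh) I _

theorem rep_coeffX (hF : ∀ i, Rep (E.F i) (F i)) (i j : Fin m) (J : Fin n →₀ ℕ) :
    Rep (E.coeffX i j J) (E.jet.coeffX F i j J) := by
  refine Rep.add (Rep.finsum (fun K => (((hF j).du E.isOpen_U i ⟨0, E.h_pos⟩ (J + K)).DxI
    E.isOpen_U K).const_mul _) ?_) (Rep.ite (Rep.sum _ fun s _ => Rep.ite
      ((((hF j).du E.isOpen_U i s 0).iterate (rep_Dt hF) s).const_mul _) rep_zero) rep_zero)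
  refine ((E.jet.finite_du i 0 (F j)).preimage (add_right_injective J).injOn).subset
    fun K hK h0 => hK ?_
  beta_reduce
  erw [h0]
  simp

theorem rep_coeffT (hF : ∀ i, Rep (E.F i) (F i)) (i j : Fin m) (r : ℕ) :
    Rep (E.coeffT i j r) (E.jet.coeffT F i j r) :=
  Rep.sum _ fun s _ => Rep.ite
      ((((hF j).du E.isOpen_U i s 0).iterate (rep_Dt hF) (s - r)).const_mul _) rep_zero

theorem rep_currentCharacteristic {J : Fin (n + 1) → JetFun n m h} {ρ : smoothAlgebra E.U}
    (hρ : Rep (J 0) ρ) (i : Fin m) :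
    Rep (E.currentCharacteristic J i) (E.jet.euler i (h - 1) ρ 1) := by
  have hh : h - 1 < h := Nat.sub_lt E.h_pos Nat.one_pos
  refine Rep.finsum (fun I => ?_) (E.jet.finite_support_euler i (h - 1) ρ 1)
  rw [mul_one]
  exact ((hρ.du E.isOpen_U i ⟨h - 1, hh⟩ I).DxI E.isOpen_U I).const_mul _

/-- Conservation makes D_t ρ minus an x-divergence, and `euler_Dx` with second argument 1
annihilates divergences. -/
theorem euler_Dt_eq_zero (hF : ∀ i, Rep (E.F i) (F i))
    {J : Fin (n + 1) → JetFun n m h} (hJ : E.IsConservedCurrent J)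
    {ρ : smoothAlgebra E.U} (hρ : Rep (J 0) ρ) (i : Fin m) (s : ℕ) :
    E.jet.euler i s (E.jet.Dt F ρ) 1 = 0 := by
  choose a ha using fun k => (hJ.1 k).exists_rep
  have h1 : E.jet.Dt F ρ + ∑ j : Fin n, E.jet.Dx j (a j.succ) = 0 := by
    refine Subtype.ext (funext fun θ => ?_)
    refine ((rep_Dt hF hρ).add (Rep.sum Finset.univ fun j _ =>
      (ha (Fin.succ j)).Dx E.isOpen_U j) θ).trans ?_
    have h2 := hJ.2 θ θ.2
    rw [Fin.sum_univ_succ] at h2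
    exact h2
  have h3 := congrArg (fun x => E.jet.euler i s x 1) h1
  simp only [E.jet.euler_add_left, E.jet.euler_sum_left, E.jet.euler_Dx, E.jet.euler_zero_left,
    Derivation.map_one_eq_zero, neg_zero] at h3
  simpa [JetAlgebra.euler] using h3

end GenEvolSystem

/-! ### Characteristic polynomials and intertwining matrices. -/

section LinearAlgebra

variable {K : Type*} [Field K]

theorem charDet_eq (A : Matrix (Fin m) (Fin m) K) : charDet A = (-1) ^ m * A.charpoly := by
  have h1 : A.map Polynomial.C - Matrix.scalar (Fin m) (Polynomial.X : Polynomial K) =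
      -A.charmatrix := by
    rw [Matrix.charmatrix, neg_sub]
    rfl
  rw [charDet, h1, Matrix.det_neg, Fintype.card_fin]
  rfl

theorem charDet_ne_zero (A : Matrix (Fin m) (Fin m) K) : charDet A ≠ 0 := by
  rw [charDet_eq]
  exact mul_ne_zero (pow_ne_zero _ (neg_ne_zero.2 one_ne_zero)) A.charpoly_monic.ne_zero

theorem hasEigenvalue_iff_aeval_charDet (A : Matrix (Fin m) (Fin m) K) (μ : AlgebraicClosure K) :
    Module.End.HasEigenvalue (Matrix.toLin' (A.map (algebraMap K (AlgebraicClosure K)))) μ ↔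
      Polynomial.aeval μ (charDet A) = 0 := by
  rw [Module.End.hasEigenvalue_iff_isRoot_charpoly, Matrix.charpoly_toLin', Matrix.charpoly_map,
    Polynomial.IsRoot.def, Polynomial.eval_map_algebraMap, charDet_eq, map_mul]
  simp

/-- The roots of d(-λ) are the negatives of the eigenvalues. A root μ of a common divisor gives the
pair μ, -μ. Conversely, for opposite eigenvalues the minimal polynomial of one of them divides both
d(λ) and d(-λ). -/
theorem hasCommonDivisor_iff (A : Matrix (Fin m) (Fin m) K) :
    HasCommonDivisor A ↔ HasOppositeEigenvalues A := by
  have hcomp : ∀ μ : AlgebraicClosure K, Polynomial.aeval μ ((charDet A).comp (-Polynomial.X)) =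
      Polynomial.aeval (-μ) (charDet A) := fun μ => by
    rw [Polynomial.aeval_comp]; simp
  constructor
  · rintro ⟨p, hp, hp1, hp2⟩
    obtain ⟨μ, hμ⟩ := IsAlgClosed.exists_aeval_eq_zero (AlgebraicClosure K) p
      (Polynomial.natDegree_pos_iff_degree_pos.1 hp).ne'
    refine ⟨μ, -μ, ?_, ?_, add_neg_cancel μ⟩
    · rw [hasEigenvalue_iff_aeval_charDet]
      exact Polynomial.aeval_eq_zero_of_dvd_aeval_eq_zero hp1 hμ
    · rw [hasEigenvalue_iff_aeval_charDet, ← hcomp]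
      exact Polynomial.aeval_eq_zero_of_dvd_aeval_eq_zero hp2 hμ
  · rintro ⟨μ₁, μ₂, h1, h2, h12⟩
    rw [hasEigenvalue_iff_aeval_charDet] at h1 h2
    refine ⟨minpoly K μ₁, minpoly.natDegree_pos (Algebra.IsIntegral.isIntegral μ₁),
      minpoly.dvd K μ₁ h1, minpoly.dvd K μ₁ ?_⟩
    rw [hcomp, ← eq_neg_of_add_eq_zero_right h12]
    exact h2

theorem aeval_mul_of_intertwine {B C S : Matrix (Fin m) (Fin m) K} (hS : B * S = S * C)
    (p : Polynomial K) : Polynomial.aeval B p * S = S * Polynomial.aeval C p := by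
  have hpow : ∀ k : ℕ, B ^ k * S = S * C ^ k := by
    intro k
    induction k with
    | zero => simp
    | succ k ih => rw [pow_succ, Matrix.mul_assoc, hS, ← Matrix.mul_assoc, ih, pow_succ,
        Matrix.mul_assoc]
  induction p using Polynomial.induction_on' with
  | add p q hp hq => rw [map_add, map_add, Matrix.add_mul, Matrix.mul_add, hp, hq]
  | monomial k a =>
    rw [Polynomial.aeval_monomial, Polynomial.aeval_monomial, ← Algebra.smul_def,
      ← Algebra.smul_def, Matrix.smul_mul, Matrix.mul_smul, hpow]

/-- S intertwines Aᵀ with -A, so S d(-A) = d(Aᵀ) S = 0 by Cayley–Hamilton. Coprimality of d(λ) and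
d(-λ), together with d(A) = 0, would make d(-A) invertible and S zero. -/
theorem hasCommonDivisor_of_intertwine {A S : Matrix (Fin m) (Fin m) K} (hS : S ≠ 0)
    (hAS : A.transpose * S + S * A = 0) : HasCommonDivisor A := by
  by_contra hno
  have hcop : IsCoprime (charDet A) ((charDet A).comp (-Polynomial.X)) := by
    classical
    rw [← EuclideanDomain.gcd_isUnit_iff]
    by_contra hunit
    have h0 : EuclideanDomain.gcd (charDet A) ((charDet A).comp (-Polynomial.X)) ≠ 0 := fun h0 =>
      charDet_ne_zero A (EuclideanDomain.gcd_eq_zero_iff.1 h0).1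
    refine hno ⟨_, Nat.pos_of_ne_zero fun hdeg => hunit ?_, EuclideanDomain.gcd_dvd_left _ _,
      EuclideanDomain.gcd_dvd_right _ _⟩
    rw [Polynomial.isUnit_iff_degree_eq_zero, Polynomial.degree_eq_natDegree h0, hdeg]
    rfl
  obtain ⟨a, b, hab⟩ := hcop
  have h1 : Polynomial.aeval A (charDet A) = 0 := by
    rw [charDet_eq, map_mul, Matrix.aeval_self_charpoly, mul_zero]
  have h2 : Polynomial.aeval A.transpose (charDet A) = 0 := by
    rw [charDet_eq, ← Matrix.charpoly_transpose, map_mul, Matrix.aeval_self_charpoly, mul_zero]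
  have h3 : Polynomial.aeval A ((charDet A).comp (-Polynomial.X)) =
      Polynomial.aeval (-A) (charDet A) := by
    rw [Polynomial.aeval_comp]; simp
  have h4 := aeval_mul_of_intertwine (B := A.transpose) (C := -A) (S := S)
    (by rw [Matrix.mul_neg]; exact eq_neg_of_add_eq_zero_left hAS) (charDet A)
  rw [h2, Matrix.zero_mul, ← h3] at h4
  have h5 := congrArg (Polynomial.aeval A) hab
  rw [mul_comm b, map_add, map_mul, map_mul, h1, mul_zero, zero_add, map_one] at h5
  refine hS ?_
  rw [← Matrix.mul_one S, ← h5, ← Matrix.mul_assoc, ← h4, Matrix.zero_mul]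

end LinearAlgebra

/-! ### The equation Aᵀ B + B A = 0 as the vanishing of a determinant. -/

open scoped Kronecker in
/-- The matrix of the linear map `S ↦ Aᵀ S + S A`. -/
def lyapunov {S : Type*} [CommRing S] (A : Matrix (Fin m) (Fin m) S) :
    Matrix (Fin m × Fin m) (Fin m × Fin m) S :=
  A.transpose ⊗ₖ 1 + 1 ⊗ₖ A.transpose

theorem lyapunov_mulVec {S : Type*} [CommRing S] (A B : Matrix (Fin m) (Fin m) S) :
    (lyapunov A).mulVec (fun p => B p.1 p.2) =
      fun p => (A.transpose * B + B * A) p.1 p.2 := by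
  ext ⟨i, l⟩
  simp only [lyapunov, Matrix.mulVec, dotProduct, Matrix.add_apply, Matrix.kroneckerMap_apply,
    Matrix.mul_apply, add_mul, Finset.sum_add_distrib, Fintype.sum_prod_type, Matrix.one_apply]
  congr 1
  · refine Finset.sum_congr rfl fun j _ => ?_
    simp
  · rw [Finset.sum_eq_single i]
    · refine Finset.sum_congr rfl fun j _ => ?_
      simp [mul_comm]
    · intro b _ hb
      simp [hb.symm]
    · simp

/-- Over a domain a singular matrix has a nonzero kernel vector with entries in the domain itself,
so the solutions may be taken with polynomial entries. The determinant is what makes solvability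
accessible to the identity theorem. -/
theorem det_lyapunov_eq_zero_iff {S : Type*} [CommRing S] [IsDomain S]
    (A : Matrix (Fin m) (Fin m) S) :
    (lyapunov A).det = 0 ↔ ∃ B : Matrix (Fin m) (Fin m) S, B ≠ 0 ∧ A.transpose * B + B * A = 0 := by
  rw [← Matrix.exists_mulVec_eq_zero_iff]
  constructor
  · rintro ⟨v, hv, h0⟩
    refine ⟨Matrix.of fun i j => v (i, j), fun hB => hv ?_, ?_⟩
    · ext ⟨i, j⟩
      exact congrFun (congrFun hB i) j
    · have h1 := lyapunov_mulVec A (Matrix.of fun i j => v (i, j))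
      ext i j
      have h2 := congrFun (h1.symm.trans h0) (i, j)
      exact h2
  · rintro ⟨B, hB, h0⟩
    refine ⟨fun p => B p.1 p.2, fun hv => hB ?_, ?_⟩
    · ext i j
      exact congrFun hv (i, j)
    · rw [lyapunov_mulVec, h0]
      rfl

theorem lyapunov_map {S T : Type*} [CommRing S] [CommRing T] (φ : S →+* T)
    (A : Matrix (Fin m) (Fin m) S) : lyapunov (A.map φ) = (lyapunov A).map φ := by
  ext ⟨i, l⟩ ⟨j, k⟩
  simp [lyapunov, Matrix.one_apply, apply_ite φ]

theorem hasCommonDivisor_map_of_intertwine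
    {A S : Matrix (Fin m) (Fin m) (MvPolynomial (Fin n) ℝ)} (hS : S ≠ 0)
    (hAS : A.transpose * S + S * A = 0) :
    HasCommonDivisor (A.map (algebraMap (MvPolynomial (Fin n) ℝ) (RatFunc n))) := by
  have hinj : Function.Injective (algebraMap (MvPolynomial (Fin n) ℝ) (RatFunc n)) :=
    IsFractionRing.injective _ _
  refine hasCommonDivisor_of_intertwine
    (S := S.map (algebraMap (MvPolynomial (Fin n) ℝ) (RatFunc n))) (fun h0 => hS ?_) ?_
  · ext1 i j
    refine hinj ?_
    simpa using congrFun (congrFun h0 i) j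
  · rw [← Matrix.transpose_map, ← Matrix.map_mul, ← Matrix.map_mul,
      ← Matrix.map_add _ (map_add _), hAS, Matrix.map_zero _ (map_zero _)]

/-! ### Orders, t-orders and symbols. -/

section Order

variable {U : Set (Jet n m h)} {k : ℕ} {f : Fin k → JetFun n m h}

/-- A supremum in ℤ is meaningful only for bounded sets. The bound comes from the finitely many
coordinates on which the components depend. -/
theorem bddAbove_orderSet (hU : IsOpen U) (hf : ∀ i, IsSmooth U (f i)) :
    BddAbove (insert (-1) {d : ℤ | ∃ (i : Fin k) (j : Fin m) (s : Fin h) (I : Fin n →₀ ℕ),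
      (∃ θ ∈ U, pd (.u j s I) (f i) θ ≠ 0) ∧ d = (I.degree : ℤ)}) := by
  choose S _ hS using fun i => (hf i).finite_pd hU (by simp)
  let deg : Coord n m h → ℤ := fun c => match c with
    | .u _ _ I => (I.degree : ℤ)
    | _ => 0
  refine BddAbove.insert _ (Set.Finite.bddAbove
    ((Set.finite_iUnion fun i => (S i).finite_toSet.image deg).subset ?_))
  rintro d ⟨i, j, s, I, ⟨θ, hθ, hpd⟩, rfl⟩
  refine Set.mem_iUnion.2 ⟨i, .u j s I, ?_, rfl⟩
  by_contra hc
  exact hpd (hS i _ hc θ hθ)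

theorem degree_le_order (hU : IsOpen U) (hf : ∀ i, IsSmooth U (f i)) {i : Fin k} {j : Fin m}
    {s : Fin h} {I : Fin n →₀ ℕ} {θ : Jet n m h} (hθ : θ ∈ U) (hpd : pd (.u j s I) (f i) θ ≠ 0) :
    (I.degree : ℤ) ≤ order U f :=
  le_csSup (bddAbove_orderSet hU hf) (Set.mem_insert_of_mem _ ⟨i, j, s, I, ⟨θ, hθ, hpd⟩, rfl⟩)

theorem exists_degree_eq_order (hU : IsOpen U) (hf : ∀ i, IsSmooth U (f i))
    (h0 : order U f ≠ -1) : ∃ (i : Fin k) (j : Fin m) (s : Fin h) (I : Fin n →₀ ℕ),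
      (∃ θ ∈ U, pd (.u j s I) (f i) θ ≠ 0) ∧ (I.degree : ℤ) = order U f := by
  rcases Int.csSup_mem (Set.insert_nonempty _ _) (bddAbove_orderSet hU hf) with h1 | h1
  · exact absurd h1 h0
  · obtain ⟨i, j, s, I, hpd, hd⟩ := h1
    exact ⟨i, j, s, I, hpd, hd.symm⟩

theorem bddAbove_tOrderSet : BddAbove {b : ℕ | ∃ (i : Fin k) (j : Fin m) (s : Fin h)
    (I : Fin n →₀ ℕ), (∃ θ ∈ U, pd (.u j s I) (f i) θ ≠ 0) ∧
      (I.degree : ℤ) = order U f ∧ b = (s : ℕ)} := by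
  refine ⟨h, ?_⟩
  rintro b ⟨i, j, s, I, -, -, rfl⟩
  exact s.2.le

theorem le_tOrder {i : Fin k} {j : Fin m} {s : Fin h} {I : Fin n →₀ ℕ} {θ : Jet n m h}
    (hθ : θ ∈ U) (hpd : pd (.u j s I) (f i) θ ≠ 0) (hI : (I.degree : ℤ) = order U f) :
    (s : ℕ) ≤ tOrder U f :=
  le_csSup bddAbove_tOrderSet ⟨i, j, s, I, ⟨θ, hθ, hpd⟩, hI, rfl⟩

theorem exists_eq_tOrder (hU : IsOpen U) (hf : ∀ i, IsSmooth U (f i))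
    (h0 : order U f ≠ -1) : ∃ (i : Fin k) (j : Fin m) (s : Fin h) (I : Fin n →₀ ℕ),
      (∃ θ ∈ U, pd (.u j s I) (f i) θ ≠ 0) ∧ (I.degree : ℤ) = order U f ∧
        tOrder U f = (s : ℕ) := by
  refine Nat.sSup_mem ?_ bddAbove_tOrderSet
  obtain ⟨i, j, s, I, hpd, hd⟩ := exists_degree_eq_order hU hf h0
  exact ⟨s, i, j, s, I, hpd, hd, rfl⟩

theorem coeff_symbolMatrix (a b : ℕ) (f : Fin k → JetFun n m h) (θ : Jet n m h) (i : Fin k)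
    (j : Fin m) (I : Fin n →₀ ℕ) :
    MvPolynomial.coeff I (symbolMatrix a b f θ i j) =
      if I.degree = a then if hb : b < h then pd (.u j ⟨b, hb⟩ I) (f i) θ else 0 else 0 := by
  simp only [symbolMatrix, Matrix.of_apply, MvPolynomial.coeff_sum, MvPolynomial.coeff_monomial]
  rw [Finset.sum_ite_eq']
  simp only [mem_finsuppAntidiag_univ]

theorem symbol_ne_zero (hU : IsOpen U) (hf : ∀ i, IsSmooth U (f i)) (h0 : order U f ≠ -1) :
    ∃ θ ∈ U, symbol U f θ ≠ 0 := by
  obtain ⟨i, j, s, I, ⟨θ, hθ, hpd⟩, hd, hs⟩ := exists_eq_tOrder hU hf h0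
  refine ⟨θ, hθ, fun h1 => hpd ?_⟩
  have h2 := congrArg (MvPolynomial.coeff I) (congrFun (congrFun h1 i) j)
  rw [symbol, coeff_symbolMatrix, if_pos (by rw [← hd]; rfl), dif_pos (by rw [hs]; exact s.2)] at h2
  simpa [hs] using h2

end Order

/-- The hypothesis is the matrix identity (-1)^h S A = (-1)^N Aᵀ S read off at the coefficient of
q^M, and the parity of N + h makes the two signs opposite. -/
theorem symbolMatrix_intertwine {k N r : ℕ} (hr : r < h) (hN0 : 0 < h) {F χ : Fin m → JetFun n m h}
    {θ : Jet n m h} (hodd : Odd (N + h))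
    (hid : ∀ i l (M : Fin n →₀ ℕ), M.degree = k + N →
      (-1 : ℝ) ^ h * ∑ j, ∑ p ∈ Finset.HasAntidiagonal.antidiagonal M,
        (if p.1.degree = k then pd (.u j ⟨r, hr⟩ p.1) (χ i) θ * pd (.u l ⟨0, hN0⟩ p.2) (F j) θ
          else 0) =
      (-1 : ℝ) ^ N * ∑ j, ∑ p ∈ Finset.HasAntidiagonal.antidiagonal M,
        (if p.1.degree = N then pd (.u i ⟨0, hN0⟩ p.1) (F j) θ * pd (.u l ⟨r, hr⟩ p.2) (χ j) θ
          else 0)) :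
    (symbolMatrix N 0 F θ).transpose * symbolMatrix k r χ θ +
      symbolMatrix k r χ θ * symbolMatrix N 0 F θ = 0 := by
  ext i l M
  simp only [Matrix.add_apply, Matrix.mul_apply, Matrix.transpose_apply, MvPolynomial.coeff_add,
    MvPolynomial.coeff_sum, MvPolynomial.coeff_mul, coeff_symbolMatrix, hr, hN0, dif_pos,
    Matrix.zero_apply, MvPolynomial.coeff_zero]
  by_cases hM : M.degree = k + N
  · have h1 := hid i l M hM
    have hsign : (-1 : ℝ) ^ h = -(-1) ^ N := by
      have h2 : (-1 : ℝ) ^ N * (-1) ^ h = -1 := by rw [← pow_add, hodd.neg_one_pow]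
      have h3 : (-1 : ℝ) ^ N * (-1) ^ N = 1 := by rw [← mul_pow]; simp
      linear_combination (-1 : ℝ) ^ N * h2 - (-1 : ℝ) ^ h * h3
    rw [hsign] at h1
    have hne : ((-1 : ℝ) ^ N) ≠ 0 := pow_ne_zero _ (by norm_num)
    have h4 : ∀ a b : ℝ, -(-1 : ℝ) ^ N * a = (-1) ^ N * b → b + a = 0 := fun a b hab => by
      have : (-1 : ℝ) ^ N * (b + a) = 0 := by linear_combination -hab
      exact (mul_eq_zero.1 this).resolve_left hne
    refine Eq.trans ?_ (h4 _ _ h1)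
    congr 1
    · refine Finset.sum_congr rfl fun j _ => Finset.sum_congr rfl fun p hp => ?_
      have hp' := congrArg Finsupp.degree (Finset.HasAntidiagonal.mem_antidiagonal.1 hp)
      rw [map_add, hM] at hp'
      by_cases h5 : p.1.degree = N
      · rw [if_pos h5, if_pos h5, if_pos (by omega)]
      · rw [if_neg h5, if_neg h5, zero_mul]
    · refine Finset.sum_congr rfl fun j _ => Finset.sum_congr rfl fun p hp => ?_
      have hp' := congrArg Finsupp.degree (Finset.HasAntidiagonal.mem_antidiagonal.1 hp)
      rw [map_add, hM] at hp'
      by_cases h5 : p.1.degree = k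
      · rw [if_pos h5, if_pos h5, if_pos (by omega)]
      · rw [if_neg h5, if_neg h5, zero_mul]
  -- Both products are homogeneous of degree k + N, so all other coefficients vanish.
  · have hz : ∀ (a b : ℕ) (x y : (Fin n →₀ ℕ) → ℝ), a + b = k + N →
        ∑ p ∈ Finset.HasAntidiagonal.antidiagonal M,
          (if p.1.degree = a then x p.1 else 0) * (if p.2.degree = b then y p.2 else 0) = 0 := by
      intro a b x y hab
      refine Finset.sum_eq_zero fun p hp => ?_
      have hp' := congrArg Finsupp.degree (Finset.HasAntidiagonal.mem_antidiagonal.1 hp)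
      rw [map_add] at hp'
      by_cases h5 : p.1.degree = a
      · rw [if_neg (by omega : ¬ p.2.degree = b), mul_zero]
      · rw [if_neg h5, zero_mul]
    rw [Finset.sum_eq_zero, Finset.sum_eq_zero, add_zero]
    · intro j _
      exact hz k N (fun I => pd (.u j ⟨r, hr⟩ I) (χ i) θ)
        (fun I => pd (.u l ⟨0, hN0⟩ I) (F j) θ) rfl
    · intro j _
      exact hz N k (fun I => pd (.u i ⟨0, hN0⟩ I) (F j) θ) (fun I => pd (.u l ⟨r, hr⟩ I) (χ j) θ)
        (add_comm _ _)

namespace GenEvolSystem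

variable {E : GenEvolSystem n m h}

theorem isSmooth_F (E : GenEvolSystem n m h) (i : Fin m) : IsSmooth E.U (E.F i) :=
  (E.smooth_F i).mono (Set.subset_univ _)

theorem order_F (hN : 0 < E.N) : order E.U E.F = E.N := by
  unfold N at hN ⊢
  omega

/-- A leading variable of F has order N > 0, and F contains variables with x-derivatives only at
level 0. -/
theorem tOrder_F (hN : 0 < E.N) : tOrder E.U E.F = 0 := by
  obtain ⟨F, hF⟩ := E.exists_rep_F
  refine Nat.le_zero.1 (csSup_le' ?_)
  rintro b ⟨i, j, s, I, ⟨θ, hθ, hpd⟩, hI, rfl⟩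
  by_contra hs
  refine hpd ?_
  rw [← (hF i).du E.isOpen_U j s I ⟨θ, hθ⟩, du_F_eq_zero hF i j s I (by omega)]
  · rfl
  · rintro rfl
    rw [order_F hN] at hI
    simp at hI
    omega

theorem bddAbove_O (E : GenEvolSystem n m h) : BddAbove (insert (-1)
    ({d : ℤ | ∃ (i j : Fin m) (J : Fin n →₀ ℕ), J.degree ≤ E.N ∧
        d = E.ord (E.coeffX i j J) - E.N} ∪
     {d : ℤ | ∃ (i j : Fin m) (r : ℕ), 0 < r ∧ r < h ∧
        d = E.ord (E.coeffT i j r) - E.N})) := by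
  refine BddAbove.insert _ (BddAbove.union (Set.Finite.bddAbove ?_) (Set.Finite.bddAbove ?_))
  · refine ((Finset.univ ×ˢ (Finset.univ ×ˢ degreeLE n E.N)).finite_toSet.image
      fun p : Fin m × Fin m × (Fin n →₀ ℕ) => E.ord (E.coeffX p.1 p.2.1 p.2.2) - E.N).subset ?_
    rintro d ⟨i, j, J, hJ, rfl⟩
    exact ⟨(i, j, J), by simpa using hJ, rfl⟩
  · refine ((Finset.univ ×ˢ (Finset.univ ×ˢ Finset.range h)).finite_toSet.image
      fun p : Fin m × Fin m × ℕ => E.ord (E.coeffT p.1 p.2.1 p.2.2) - E.N).subset ?_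
    rintro d ⟨i, j, r, -, hr, rfl⟩
    exact ⟨(i, j, r), by simpa using hr, rfl⟩

theorem du_eq_zero_of_ord_lt {c : JetFun n m h} {a : smoothAlgebra E.U} (hc : Rep c a)
    {I : Fin n →₀ ℕ} (hI : E.ord c < I.degree) (l : Fin m) (s : ℕ) : E.jet.du l s I a = 0 := by
  by_cases hs : s < h
  · refine Subtype.ext (funext fun θ => ?_)
    rw [hc.du E.isOpen_U l ⟨s, hs⟩ I θ]
    by_contra hpd
    exact hI.not_ge (degree_le_order (f := fun _ : Fin 1 => c) E.isOpen_U (fun _ => hc.isSmooth)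
      (i := 0) θ.2 hpd)
  · exact E.jet.du_of_le l (not_lt.1 hs) I a

theorem du_F_eq_zero_of_lt {F : Fin m → smoothAlgebra E.U} (hF : ∀ i, Rep (E.F i) (F i))
    (j l : Fin m) (I : Fin n →₀ ℕ) (hI : E.N < I.degree) : E.jet.du l 0 I (F j) = 0 := by
  refine Subtype.ext (funext fun θ => ?_)
  rw [(hF j).du E.isOpen_U l ⟨0, E.h_pos⟩ I θ]
  by_contra hpd
  have h1 := degree_le_order E.isOpen_U E.isSmooth_F θ.2 hpd
  unfold N at hI
  omega

/-- The symbol of the characteristic intertwines the symbol of the system with minus its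
transpose. -/
theorem symbol_intertwine (hN : 0 < E.N) (hodd : Odd (E.N + h))
    {J : Fin (n + 1) → JetFun n m h} (hJ : E.IsConservedCurrent J) {χ : Fin m → JetFun n m h}
    (hχ : ∀ i, ∀ θ ∈ E.U, χ i θ = E.currentCharacteristic J i θ)
    (hO : E.O < order E.U χ) {θ : Jet n m h} (hθ : θ ∈ E.U) :
    (symbol E.U E.F θ).transpose * symbol E.U χ θ + symbol E.U χ θ * symbol E.U E.F θ = 0 := by
  obtain ⟨F, hF⟩ := E.exists_rep_F
  obtain ⟨ρ, hρ⟩ := (hJ.1 0).exists_rep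
  let X : Fin m → smoothAlgebra E.U := fun i => E.jet.euler i (h - 1) ρ 1
  have hX : ∀ i, Rep (χ i) (X i) := fun i => (rep_currentCharacteristic hρ i).congr (hχ i)
  have hXs : ∀ i, IsSmooth E.U (χ i) := fun i => (hX i).isSmooth
  -- O is at least -1 by definition, so χ has order at least 0 and its order and t-order are
  -- attained.
  have hO1 : -1 < order E.U χ :=
    lt_of_le_of_lt (le_csSup E.bddAbove_O (Set.mem_insert _ _)) hO
  obtain ⟨-, -, s₀, -, -, -, hs₀⟩ := exists_eq_tOrder E.isOpen_U hXs hO1.ne'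
  have hr : tOrder E.U χ < h := hs₀ ▸ s₀.2
  have hordk : order E.U χ = ((order E.U χ).toNat : ℤ) := by omega
  have hFN := du_F_eq_zero_of_lt hF
  have hF0 := du_F_eq_zero hF
  have hk : ∀ i l s I, (order E.U χ).toNat < I.degree → E.jet.du l s I (X i) = 0 := by
    intro i l s I hI
    by_cases hs : s < h
    · refine Subtype.ext (funext fun θ => ?_)
      rw [(hX i).du E.isOpen_U l ⟨s, hs⟩ I θ]
      by_contra hpd
      have := degree_le_order E.isOpen_U hXs θ.2 hpd
      omega
    · exact E.jet.du_of_le l (not_lt.1 hs) I _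
  have hkr : ∀ i l s I, I.degree = (order E.U χ).toNat → tOrder E.U χ < s →
      E.jet.du l s I (X i) = 0 := by
    intro i l s I hI hrs
    by_cases hs : s < h
    · refine Subtype.ext (funext fun θ => ?_)
      rw [(hX i).du E.isOpen_U l ⟨s, hs⟩ I θ]
      by_contra hpd
      have : s ≤ _ := le_tOrder θ.2 hpd (by omega)
      omega
    · exact E.jet.du_of_le l (not_lt.1 hs) I _
  -- Here order above O enters: each coefficient has order at most O + N, which is less than k + N.
  have hcX : ∀ i j J l s I, J.degree ≤ E.N → (order E.U χ).toNat + E.N ≤ I.degree →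
      E.jet.du l s I (E.jet.coeffX F i j J) = 0 := by
    intro i j J l s I hJ hI
    refine du_eq_zero_of_ord_lt (rep_coeffX hF i j J) ?_ l s
    have h1 : E.ord (E.coeffX i j J) - E.N ≤ E.O := le_csSup E.bddAbove_O
      (Set.mem_insert_of_mem _ (Or.inl ⟨i, j, J, hJ, rfl⟩))
    omega
  have hcT : ∀ i j r' l s I, 0 < r' → r' < h → (order E.U χ).toNat + E.N ≤ I.degree →
      E.jet.du l s I (E.jet.coeffT F i j r') = 0 := by
    intro i j r' l s I hr0 hrh hI
    refine du_eq_zero_of_ord_lt (rep_coeffT hF i j r') ?_ l s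
    have h1 : E.ord (E.coeffT i j r') - E.N ≤ E.O := le_csSup E.bddAbove_O
      (Set.mem_insert_of_mem _ (Or.inr ⟨i, j, r', hr0, hrh, rfl⟩))
    omega
  rw [symbol, symbol, order_F hN, tOrder_F hN, Int.toNat_natCast]
  refine symbolMatrix_intertwine hr E.h_pos hodd fun i l M hM => ?_
  have heq := (E.jet.iterate_neg_Dt_euler F E.h_pos i ρ
    fun s _ => euler_Dt_eq_zero hF hJ hρ i s).trans
    (E.jet.adjoint_eq_sum_coeff E.h_pos hFN hF0 i X)
  have hid := E.jet.leading_identity hN hFN hF0 hr hk hkr hcX hcT i heq l hM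
  have hL := (Rep.sum Finset.univ fun j _ => Rep.sum
    (Finset.HasAntidiagonal.antidiagonal M) fun p _ =>
      Rep.ite (p := p.1.degree = (order E.U χ).toNat)
      (((hX i).du E.isOpen_U j ⟨_, hr⟩ p.1).mul ((hF j).du E.isOpen_U l ⟨0, E.h_pos⟩ p.2))
      rep_zero).const_mul ((-1 : ℝ) ^ h)
  have hR := (Rep.sum Finset.univ fun j _ => Rep.sum
    (Finset.HasAntidiagonal.antidiagonal M) fun p _ => Rep.ite (p := p.1.degree = E.N)
      (((hF j).du E.isOpen_U i ⟨0, E.h_pos⟩ p.1).mul ((hX j).du E.isOpen_U l ⟨_, hr⟩ p.2))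
      rep_zero).const_mul ((-1 : ℝ) ^ E.N)
  exact ((hL ⟨θ, hθ⟩).symm.trans (congrFun (congrArg Subtype.val hid) ⟨θ, hθ⟩)).trans
    (hR ⟨θ, hθ⟩)

end GenEvolSystem

/-! ### Analytic dependence on the jet and the identity theorem. -/

section Analytic

variable {U : Set (Jet n m h)} {V : Set (Coord n m h)} {r : WithTop ℕ∞}

theorem IsFunOf.sum {ι : Type*} (s : Finset ι) {f : ι → JetFun n m h}
    (hf : ∀ i ∈ s, IsFunOf U V r (f i)) : IsFunOf U V r (fun θ => ∑ i ∈ s, f i θ) := by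
  classical
  induction s using Finset.induction with
  | empty => simpa using IsFunOf.const U V r 0
  | insert a s ha ih =>
    simp_rw [Finset.sum_insert ha]
    exact (hf a (Finset.mem_insert_self _ _)).add
      (ih fun i hi => hf i (Finset.mem_insert_of_mem hi))

theorem IsFunOf.prod {ι : Type*} (s : Finset ι) {f : ι → JetFun n m h}
    (hf : ∀ i ∈ s, IsFunOf U V r (f i)) : IsFunOf U V r (fun θ => ∏ i ∈ s, f i θ) := by
  classical
  induction s using Finset.induction with
  | empty => simpa using IsFunOf.const U V r 1
  | insert a s ha ih =>
    simp_rw [Finset.prod_insert ha]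
    exact (hf a (Finset.mem_insert_self _ _)).mul
      (ih fun i hi => hf i (Finset.mem_insert_of_mem hi))

theorem IsFunOf.det {ι : Type*} [Fintype ι] [DecidableEq ι] {B : Jet n m h → Matrix ι ι ℝ}
    (hB : ∀ i j, IsFunOf U V r (fun θ => B θ i j)) : IsFunOf U V r (fun θ => (B θ).det) := by
  simp_rw [Matrix.det_apply']
  exact IsFunOf.sum _ fun σ _ => (IsFunOf.const U V r _).mul (IsFunOf.prod _ fun i _ => hB _ _)

theorem IsFunOf.continuousOn {f : JetFun n m h} (hf : IsFunOf U V r f) : ContinuousOn f U := by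
  obtain ⟨s, -, g, hg, hfg⟩ := hf
  have hc : Continuous (s.restrict : Jet n m h → (s → ℝ)) :=
    continuous_pi fun i => continuous_apply _
  exact (hg.continuousOn.comp hc.continuousOn (Set.mapsTo_image _ _)).congr hfg

/-- The identity theorem for analytic functions of finitely many jet coordinates. -/
theorem IsFunOf.eq_zero_of_isPreconnected (hU : IsOpen U) (hconn : IsPreconnected U)
    {f : JetFun n m h} (hf : IsFunOf U V ω f) {W : Set (Jet n m h)} (hW : IsOpen W) (hWU : W ⊆ U)
    (hne : W.Nonempty) (h0 : ∀ θ ∈ W, f θ = 0) : ∀ θ ∈ U, f θ = 0 := by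
  obtain ⟨s, -, g, hg, hfg⟩ := hf
  obtain ⟨θ₀, hθ₀⟩ := hne
  have hc : Continuous (s.restrict : Jet n m h → (s → ℝ)) :=
    continuous_pi fun i => continuous_apply _
  have hg' : AnalyticOnNhd ℝ g (s.restrict '' U) := by
    intro y hy
    exact (hg.contDiffAt ((isOpen_restrict_image hU s).mem_nhds hy)).analyticAt
  -- The image of W under restriction is open, so vanishing on W makes g vanish near a point of the
  -- finite-dimensional image of U.
  have h1 : g =ᶠ[nhds (s.restrict θ₀)] 0 := by
    filter_upwards [(isOpen_restrict_image hW s).mem_nhds ⟨θ₀, hθ₀, rfl⟩]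
    rintro _ ⟨θ, hθ, rfl⟩
    rw [← hfg θ (hWU hθ), h0 θ hθ]
    rfl
  have h2 := hg'.eqOn_zero_of_preconnected_of_eventuallyEq_zero (hconn.image _ hc.continuousOn)
    ⟨θ₀, hWU hθ₀, rfl⟩ h1
  intro θ hθ
  rw [hfg θ hθ]
  exact h2 ⟨θ, hθ, rfl⟩

theorem IsFunOf.eval_symbolMatrix (hU : IsOpen U) {k : ℕ} {f : Fin k → JetFun n m h}
    {r' : WithTop ℕ∞} (hr : r' + 1 ≤ r) (hf : ∀ i, IsFunOf U V r (f i)) (a b : ℕ)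
    (q : Fin n → ℝ) (i : Fin k) (j : Fin m) :
    IsFunOf U V r' (fun θ => MvPolynomial.eval q (symbolMatrix a b f θ i j)) := by
  simp only [symbolMatrix, Matrix.of_apply, map_sum, MvPolynomial.eval_monomial]
  refine IsFunOf.sum _ fun I _ => IsFunOf.mul ?_ (IsFunOf.const U V r' _)
  split_ifs
  · exact (hf i).pd hU hr _
  · exact IsFunOf.const U V r' 0

theorem IsFunOf.eval_det_lyapunov (hU : IsOpen U) {f : Fin m → JetFun n m h}
    (hf : ∀ i, IsFunOf U V ω (f i)) (a b : ℕ) (q : Fin n → ℝ) :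
    IsFunOf U V ω (fun θ => MvPolynomial.eval q (lyapunov (symbolMatrix a b f θ)).det) := by
  simp_rw [RingHom.map_det, RingHom.mapMatrix_apply, ← lyapunov_map]
  refine IsFunOf.det ?_
  rintro ⟨i, l⟩ ⟨j, k⟩
  simp only [lyapunov, Matrix.add_apply, Matrix.kroneckerMap_apply, Matrix.transpose_apply,
    Matrix.map_apply]
  exact ((IsFunOf.eval_symbolMatrix hU le_rfl hf a b q j i).mul (IsFunOf.const U V ω _)).add
    ((IsFunOf.const U V ω _).mul (IsFunOf.eval_symbolMatrix hU le_rfl hf a b q k l))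

end Analytic

/-- A nonzero coefficient of the symbol is a continuous function on U and stays nonzero nearby. -/
theorem exists_isOpen_symbol_ne_zero {U : Set (Jet n m h)} (hU : IsOpen U) {k : ℕ}
    {f : Fin k → JetFun n m h} (hf : ∀ i, IsSmooth U (f i)) {θ : Jet n m h} (hθ : θ ∈ U)
    (hs : symbol U f θ ≠ 0) :
    ∃ W, IsOpen W ∧ W ⊆ U ∧ θ ∈ W ∧ ∀ η ∈ W, symbol U f η ≠ 0 := by
  have h1 : ∃ i j I, MvPolynomial.coeff I (symbol U f θ i j) ≠ 0 := by
    by_contra! h1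
    refine hs ?_
    ext i j I
    exact h1 i j I
  obtain ⟨i, j, I, hI⟩ := h1
  rw [symbol, coeff_symbolMatrix] at hI
  split_ifs at hI with hd hb
  · refine ⟨U ∩ (pd (.u j ⟨_, hb⟩ I) (f i)) ⁻¹' {0}ᶜ,
      ((hf i).pd hU infty_add_one_le _).continuousOn.isOpen_inter_preimage hU
        isOpen_compl_singleton, Set.inter_subset_left, ⟨hθ, hI⟩, fun η hη h0 => hη.2 ?_⟩
    have h2 := congrArg (MvPolynomial.coeff I) (congrFun (congrFun h0 i) j)
    rw [symbol, coeff_symbolMatrix, if_pos hd, dif_pos hb] at h2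
    simpa using h2
  · exact absurd rfl hI
  · exact absurd rfl hI

/-- If a nonzero solution of `Aᵀ S + S A = 0` exists on a nonempty open set, then one exists on the
whole connected domain of an analytic system. -/
theorem GenEvolSystem.exists_intertwine_of_analytic (E : GenEvolSystem n m h)
    (hconn : IsPreconnected E.U) (hF : ∀ i, IsFunOf E.U Set.univ ω (E.F i))
    {W : Set (Jet n m h)} (hW : IsOpen W) (hWU : W ⊆ E.U) (hne : W.Nonempty)
    (h0 : ∀ θ ∈ W, ∃ B : Matrix (Fin m) (Fin m) (MvPolynomial (Fin n) ℝ), B ≠ 0 ∧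
      (symbol E.U E.F θ).transpose * B + B * symbol E.U E.F θ = 0)
    {θ : Jet n m h} (hθ : θ ∈ E.U) :
    ∃ B : Matrix (Fin m) (Fin m) (MvPolynomial (Fin n) ℝ), B ≠ 0 ∧
      (symbol E.U E.F θ).transpose * B + B * symbol E.U E.F θ = 0 := by
  rw [← det_lyapunov_eq_zero_iff]
  -- Over ℝ a polynomial is determined by its values. Fixing a real q leaves a scalar analytic
  -- function of θ, to which the identity theorem applies.
  refine MvPolynomial.funext fun q => ?_
  rw [map_zero]
  refine (IsFunOf.eval_det_lyapunov E.isOpen_U hF _ _ q).eq_zero_of_isPreconnected E.isOpen_U hconn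
    hW hWU hne (fun η hη => ?_) θ hθ
  have h1 := (det_lyapunov_eq_zero_iff _).2 (h0 η hη)
  rw [symbol] at h1
  rw [h1, map_zero]

end GenEvol

end

/-! ### The theorem. -/

theorem theorem4 {n m h : ℕ} (E : GenEvol.GenEvolSystem n m h) (hN : 0 < E.N)
    (hodd : Odd (E.N + h))
    (c : Set (Fin (n + 1) → GenEvol.JetFun n m h)) (hc : E.IsConservationLaw c)
    (χ : Fin m → GenEvol.JetFun n m h) (hχ : E.IsCharacteristic c χ)
    (hO : E.O < GenEvol.order E.U χ) :
    (∃ θ ∈ E.U, GenEvol.symbol E.U χ θ ≠ 0) ∧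
    (∀ θ ∈ E.U, GenEvol.symbol E.U χ θ ≠ 0 →
      GenEvol.HasCommonDivisor (E.A θ) ∧ GenEvol.HasOppositeEigenvalues (E.A θ)) ∧
    (IsPreconnected E.U → (∀ i, GenEvol.IsFunOf E.U Set.univ ω (E.F i)) →
      ∀ θ ∈ E.U,
        GenEvol.HasCommonDivisor (E.A θ) ∧ GenEvol.HasOppositeEigenvalues (E.A θ)) ∧
    (∀ θ ∈ E.U,
      GenEvol.HasCommonDivisor (E.A θ) ↔ GenEvol.HasOppositeEigenvalues (E.A θ)) := by
  obtain ⟨J₀, hJ₀, rfl⟩ := hc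
  obtain ⟨J, ⟨hJ, -⟩, hχJ⟩ := hχ
  have hsmooth : ∀ i, GenEvol.IsSmooth E.U (χ i) := fun i => by
    obtain ⟨ρ, hρ⟩ := (hJ.1 0).exists_rep
    exact ((GenEvol.GenEvolSystem.rep_currentCharacteristic hρ i).congr (hχJ i)).isSmooth
  have hO1 : -1 < GenEvol.order E.U χ :=
    lt_of_le_of_lt (le_csSup E.bddAbove_O (Set.mem_insert _ _)) hO
  have hint := fun θ (hθ : θ ∈ E.U) =>
    GenEvol.GenEvolSystem.symbol_intertwine hN hodd hJ hχJ hO hθ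
  have hboth : ∀ (θ : GenEvol.Jet n m h)
      (B : Matrix (Fin m) (Fin m) (MvPolynomial (Fin n) ℝ)), B ≠ 0 →
      (GenEvol.symbol E.U E.F θ).transpose * B + B * GenEvol.symbol E.U E.F θ = 0 →
      GenEvol.HasCommonDivisor (E.A θ) ∧ GenEvol.HasOppositeEigenvalues (E.A θ) := by
    intro θ B hB hAB
    have h1 : GenEvol.HasCommonDivisor (E.A θ) :=
      GenEvol.hasCommonDivisor_map_of_intertwine hB hAB
    exact ⟨h1, (GenEvol.hasCommonDivisor_iff _).1 h1⟩
  obtain ⟨θ₀, hθ₀, hne₀⟩ := GenEvol.symbol_ne_zero E.isOpen_U hsmooth hO1.ne'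
  refine ⟨⟨θ₀, hθ₀, hne₀⟩, fun θ hθ hne => hboth θ _ hne (hint θ hθ), fun hconn hF θ hθ => ?_,
    fun θ _ => GenEvol.hasCommonDivisor_iff _⟩
  -- On W the symbol of χ itself is a nonzero solution. Elsewhere it may vanish, and the solution
  -- comes from analytic continuation of the determinant.
  obtain ⟨W, hW, hWU, hθ₀W, hWne⟩ :=
    GenEvol.exists_isOpen_symbol_ne_zero E.isOpen_U hsmooth hθ₀ hne₀
  obtain ⟨B, hB, hAB⟩ := E.exists_intertwine_of_analytic hconn hF hW hWU ⟨θ₀, hθ₀W⟩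
    (fun η hη => ⟨_, hWne η hη, hint η (hWU hη)⟩) hθ
  exact hboth θ B hB hAB
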